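/- Work on $\mathbb{R}^3$ with standard coordinates, Euclidean metric $\delta$ and $\sigma(x)=(1+|x|^2)^{1/2}$. For an integer $m\ge 0$ and $\gamma\in\mathbb{R}$ let $H^{m,\gamma}$ be the space of tensor fields $T$ with weak derivatives up to order $m$ and finite norm $$\|T\|_{H^{m,\gamma}}=\Big(\sum_{l=0}^{m}\int_{\mathbb{R}^3}\|D^lT\|^2\,\sigma^{-2(\gamma-l)-3}\Big)^{1/2}.$$ Let $\mathcal{S}^2$ denote the symmetric 2-tensors, $\mathcal{S}^2_{TT}$ those that are in addition $\delta$-trace-free and $\delta$-divergence-free, and $\mathcal{J}$ the 3-tensors with $J_{abc}+J_{cab}+J_{bca}=0$ and $J_{abc}+J_{acb}=0$. For a metric $g$ with Levi-Civita connection $\nabla$ and volume form $\varepsilon$, and $J\in\mathcal{J}$, put $$[\mathcal{D}_g^*(J)]_{ac}=\nabla^bJ_{abc}+\nabla^bJ_{cba}-\tfrac23\nabla^bJ_{ubv}\,g^{uv}g_{ac},\qquad [\mathcal{Q}_g(J)]_a=\varepsilon^{ebc}\nabla_eJ_{abc},\qquad \mathcal{P}_g(J)=(\mathcal{D}_g^*(J),\mathcal{Q}_g(J)).$$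 Proposition. Let $k\ge 4$ be an integer and $\beta\in(-1,0)$. (1) There is $\varepsilon_0>0$ such that for every $h\in H^{k,\beta}(\mathcal{S}^2)$ with $\|h\|_{H^{k,\beta}}\le\varepsilon_0$ the operator $\mathcal{P}_{\delta+h}$ is injective on $H^{k-2,\beta-2}(\mathcal{J})$. (2) Consequently, let $\mathcal{B}=H^{k-2,\beta-2}(\mathcal{S}^2_{TT})\times H^{k-2,\beta-2}(\mathcal{S}^2_{TT})\times H^{k-1,\beta-1}(\mathbb{R}^3)$ be the space of free data $b=(T,\bar T,\phi)$, normed by the sum of the norms of its components, and let $b\mapsto h(b)$ be any map, defined for small $b\in\mathcal{B}$, with values in $H^{k,\beta}(\mathcal{S}^2)$ and such that $h(b)\to h(0)=0$ in $H^{k,\beta}$ as $b\to 0$. Then there is $\varepsilon_0>0$ such that $\mathcal{P}_{\delta+h(b)}$ is injective on $H^{k-2,\beta-2}(\mathcal{J})$ for every $b\in\mathcal{B}$ of norm at most $\varepsilon_0$. -/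

import Mathlib

open MeasureTheory
open scoped ENNReal ContDiff

noncomputable section

namespace ExtConstraint

/-- Euclidean three-space. -/
abbrev E3 : Type := EuclideanSpace ℝ (Fin 3)

/-- Covariant tensor fields of rank `r` on `ℝ³`, given by their components in the standard
coordinates; `T ![a, b] x` is the component `T_{ab}(x)`. -/
abbrev TensorField (r : ℕ) : Type := (Fin r → Fin 3) → E3 → ℝ

/-- Equality of tensor fields almost everywhere. Elements of Sobolev spaces are tensor fields up to
this relation. -/
def AEEq {r : ℕ} (S T : TensorField r) : Prop :=
  ∀ I : Fin r → Fin 3, S I =ᵐ[volume] T I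

/-! ### Weak derivatives -/

/-- `g` is a weak `i`-th partial derivative of `f`. -/
def HasWeakPartial (i : Fin 3) (f g : E3 → ℝ) : Prop :=
  LocallyIntegrable f volume ∧ LocallyIntegrable g volume ∧
    ∀ φ : E3 → ℝ, ContDiff ℝ ∞ φ → HasCompactSupport φ →
      ∫ x, f x * fderiv ℝ φ x (EuclideanSpace.single i 1) = -∫ x, g x * φ x

open Classical in
/-- The weak partial derivative `∂_i f` (unique up to null sets); by convention it is `0` if there
is none. -/
def wpartial (i : Fin 3) (f : E3 → ℝ) : E3 → ℝ :=
  if h : ∃ g, HasWeakPartial i f g then h.choose else 0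

/-- Iterated weak partial derivatives: `wderiv [i₁, …, iₗ] f = ∂_{i₁} ⋯ ∂_{iₗ} f`. -/
def wderiv : List (Fin 3) → (E3 → ℝ) → E3 → ℝ
  | [], f => f
  | i :: s, f => wpartial i (wderiv s f)

/-- `f` has weak derivatives of all orders up to `k`. -/
def WeaklyDifferentiable (k : ℕ) (f : E3 → ℝ) : Prop :=
  (∀ s : List (Fin 3), s.length ≤ k → LocallyIntegrable (wderiv s f) volume) ∧
    ∀ s : List (Fin 3), s.length < k → ∀ i : Fin 3,
      HasWeakPartial i (wderiv s f) (wderiv (i :: s) f)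

/-! ### Weighted Sobolev spaces -/

/-- The weight function `σ(x) = (1 + |x|²)^{1/2}`. -/
def weight (x : E3) : ℝ := Real.sqrt (1 + ‖x‖ ^ 2)

/-- The weighted Sobolev norm
`‖T‖_{H^{k,β}} = (∑_{l ≤ k} ∫ |D^l T|² σ^{-2(β-l)-3})^{1/2}`, with values in `[0, ∞]`; `|D^l T|²` is
the sum of the squares of all components of the tensor `D^l T`. -/
def sobolevNorm (k : ℕ) (β : ℝ) {r : ℕ} (T : TensorField r) : ℝ≥0∞ :=
  (∑ l ∈ Finset.range (k + 1), ∑ I : Fin r → Fin 3, ∑ s : Fin l → Fin 3,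
    ∫⁻ x, ENNReal.ofReal
      ((wderiv (List.ofFn s) (T I) x) ^ 2 * weight x ^ (-2 * (β - (l : ℝ)) - 3))) ^ (1 / 2 : ℝ)

/-- The weighted Sobolev space `H^{k,β}` of tensor fields of rank `r`. -/
def MemSobolev (k : ℕ) (β : ℝ) {r : ℕ} (T : TensorField r) : Prop :=
  (∀ I : Fin r → Fin 3, WeaklyDifferentiable k (T I)) ∧ sobolevNorm k β T < ⊤

/-! ### Spaces of tensors -/

/-- Symmetric two-tensors (`𝒮²`). -/
def IsSymmetric (T : TensorField 2) : Prop :=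
  ∀ a b : Fin 3, T ![a, b] =ᵐ[volume] T ![b, a]

/-- The three-tensors (`𝒥`) with the symmetries `J_{abc} + J_{cab} + J_{bca} = 0` and
`J_{abc} + J_{acb} = 0`. -/
def IsJacobi (J : TensorField 3) : Prop :=
  ∀ a b c : Fin 3, ∀ᵐ x ∂(volume : Measure E3),
    J ![a, b, c] x + J ![c, a, b] x + J ![b, c, a] x = 0 ∧
      J ![a, b, c] x + J ![a, c, b] x = 0

/-- Symmetric, `δ`-trace-free and `δ`-divergence-free two-tensors (`𝒮²_TT`). -/
def IsTT (T : TensorField 2) : Prop :=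
  IsSymmetric T ∧ (∀ᵐ x ∂(volume : Measure E3), ∑ a : Fin 3, T ![a, a] x = 0) ∧
    ∀ b : Fin 3, ∀ᵐ x ∂(volume : Measure E3), ∑ a : Fin 3, wpartial a (T ![a, b]) x = 0

/-! ### Riemannian geometry in the standard coordinates -/

/-- The Euclidean metric `δ`. -/
def euclid : TensorField 2 := fun I _ => if I 0 = I 1 then 1 else 0

/-- The matrix `(g_{ab}(x))` of a two-tensor. -/
def gram (g : TensorField 2) (x : E3) : Matrix (Fin 3) (Fin 3) ℝ :=
  Matrix.of fun a b => g ![a, b] x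

/-- The inverse metric `g^{ab}(x)`. -/
def ginv (g : TensorField 2) (a b : Fin 3) (x : E3) : ℝ := (gram g x)⁻¹ a b

/-- The Christoffel symbols
`Γ^c_{ab} = ½ g^{cd} (∂_a g_{bd} + ∂_b g_{ad} - ∂_d g_{ab})`. -/
def christoffel (g : TensorField 2) (c a b : Fin 3) (x : E3) : ℝ :=
  (1 / 2) * ∑ d : Fin 3, ginv g c d x *
    (wpartial a (g ![b, d]) x + wpartial b (g ![a, d]) x - wpartial d (g ![a, b]) x)

/-- The covariant derivative `∇_d J_{abc}` of a covariant three-tensor. -/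
def covDeriv (g : TensorField 2) (J : TensorField 3) (d a b c : Fin 3) (x : E3) : ℝ :=
  wpartial d (J ![a, b, c]) x
    - ∑ e : Fin 3, (christoffel g e d a x * J ![e, b, c] x
      + christoffel g e d b x * J ![a, e, c] x
      + christoffel g e d c x * J ![a, b, e] x)

/-- The permutation symbol on `{0, 1, 2}`: the sign of `(a, b, c)`, and `0` if two indices agree. -/
def permSymbol (a b c : Fin 3) : ℝ :=
  (((b : ℕ) : ℝ) - (a : ℕ)) * (((c : ℕ) : ℝ) - (b : ℕ)) * (((c : ℕ) : ℝ) - (a : ℕ)) / 2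

/-- The volume form `ε_{abc} = (det g)^{1/2} [abc]` of `g`. -/
def volForm (g : TensorField 2) (a b c : Fin 3) (x : E3) : ℝ :=
  Real.sqrt (gram g x).det * permSymbol a b c

/-- The volume form with all indices raised,
`ε^{abc} = g^{ai} g^{bj} g^{ck} ε_{ijk}`. -/
def volFormUp (g : TensorField 2) (a b c : Fin 3) (x : E3) : ℝ :=
  ∑ i : Fin 3, ∑ j : Fin 3, ∑ k : Fin 3,
    ginv g a i x * ginv g b j x * ginv g c k x * volForm g i j k x

/-- The operator `𝒟*_g`, with
`[𝒟*_g(J)]_{ac} = ∇^b J_{abc} + ∇^b J_{cba} - (2/3) ∇^b J_{ubv} g^{uv} g_{ac}`. -/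
def adjD (g : TensorField 2) (J : TensorField 3) : TensorField 2 := fun I x =>
  (∑ b : Fin 3, ∑ d : Fin 3, ginv g b d x * covDeriv g J d (I 0) b (I 1) x)
    + (∑ b : Fin 3, ∑ d : Fin 3, ginv g b d x * covDeriv g J d (I 1) b (I 0) x)
    - (2 / 3) * (∑ b : Fin 3, ∑ d : Fin 3, ∑ u : Fin 3, ∑ v : Fin 3,
        ginv g b d x * covDeriv g J d u b v x * ginv g u v x) * g ![I 0, I 1] x

/-- The operator `𝒬_g`, with `[𝒬_g(J)]_a = ε^{ebc} ∇_e J_{abc}`. -/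
def opQ (g : TensorField 2) (J : TensorField 3) : TensorField 1 := fun I x =>
  ∑ e : Fin 3, ∑ b : Fin 3, ∑ c : Fin 3, volFormUp g e b c x * covDeriv g J e (I 0) b c x

/-- The auxiliary operator `𝒫 = (𝒟*_g, 𝒬_g)` of the metric `g = δ + h`. -/
def auxOp (h : TensorField 2) (J : TensorField 3) : TensorField 2 × TensorField 1 :=
  (adjD (euclid + h) J, opQ (euclid + h) J)

/-- The operator `𝒫 = (𝒟*_g, 𝒬_g)`, `g = δ + h`, is injective on `H^{m,γ}(𝒥)`. -/
def AuxOpInjective (m : ℕ) (γ : ℝ) (h : TensorField 2) : Prop :=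
  ∀ J₁ J₂ : TensorField 3,
    MemSobolev m γ J₁ → IsJacobi J₁ → MemSobolev m γ J₂ → IsJacobi J₂ →
    AEEq (auxOp h J₁).1 (auxOp h J₂).1 → AEEq (auxOp h J₁).2 (auxOp h J₂).2 → AEEq J₁ J₂

/-! ### Free data -/

/-- Triples `(T, T̄, φ)` of two two-tensors and a function. -/
structure DataTriple where
  T : TensorField 2
  Tbar : TensorField 2
  phi : E3 → ℝ

/-- A function as a tensor field of rank `0`. -/
def scalarField (f : E3 → ℝ) : TensorField 0 := fun _ => f

/-- The space `ℬ = H^{k-2,β-2}(𝒮²_TT) × H^{k-2,β-2}(𝒮²_TT) × H^{k-1,β-1}(ℝ³)` of free data. -/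
def IsFreeData (k : ℕ) (β : ℝ) (b : DataTriple) : Prop :=
  (MemSobolev (k - 2) (β - 2) b.T ∧ IsTT b.T) ∧
    (MemSobolev (k - 2) (β - 2) b.Tbar ∧ IsTT b.Tbar) ∧
      MemSobolev (k - 1) (β - 1) (scalarField b.phi)

/-- The norm of the space `ℬ` of free data. -/
def freeDataNorm (k : ℕ) (β : ℝ) (b : DataTriple) : ℝ≥0∞ :=
  sobolevNorm (k - 2) (β - 2) b.T + sobolevNorm (k - 2) (β - 2) b.Tbar
    + sobolevNorm (k - 1) (β - 1) (scalarField b.phi)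

end ExtConstraint

end

noncomputable section

namespace ExtConstraint

open Filter Topology Metric ContinuousLinearMap Convolution

/-! The operator is linear in `J`, so injectivity means that a difference `J = J₁ - J₂` with the
same image vanishes. Since `β < 0`, the weights force `J` and its derivatives up to order two into
unweighted `L²`. The argument is a flat coercivity estimate followed by a perturbation.

Flat estimate. Writing `J_{abc} = ε_{bcd} M_{ad}` turns a Jacobi tensor into a trace-free matrix
field `M`. Then `𝒟*_δ` is, up to sign, twice the symmetrised trace-free part of the row-wise curl of
`M`, and `𝒬_δ` is twice the row-wise divergence. Pointwise these are only 8 combinations of 24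
derivatives. After adding suitable 2×2 Jacobian minors, `|𝒫_δ J|²` dominates `|∂J|²/4`
(`sqNorm_le_flat`). The minors are null Lagrangians, with vanishing integral on `H²`, so `∫|∂J|² ≤ 4
∫|𝒫_δ J|²` (`integral_sqNorm_le`). Hardy's inequality (`integral_hardy_le`) adds `∫|J|² σ⁻² ≤ 4
∫|∂J|²`.

Perturbation. A weighted Sobolev embedding (`exists_ae_bound`) gives `|h| ≤ Cε` and `|∂h| ≤ Cε σ⁻¹`.
It rests on the `L¹` bound of a compactly supported function by its mixed third derivative. Hence
the metric, its inverse and its volume density are within `τ` of the flat ones, and the Christoffel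
symbols are at most `τ σ⁻¹`. If `𝒫_g J = 0`, then `|𝒫_δ J|` is at most a constant times `τ (|∂J| +
σ⁻¹|J|)` (`abs_flat_le`). The decay `σ⁻¹` of the Christoffel symbols is exactly what Hardy's
inequality can absorb. For small `τ` the estimates force `∂J = 0` and then `J = 0`
(`ae_eq_zero_of_flat_le`).

The second claim composes the uniform threshold of the first with the continuity of `b ↦ h(b)` at
`0`. -/

/-! ### Algebra of the flat symbol -/

/-- The trace-free matrix that represents the last two (antisymmetric) slots of a Jacobi tensor by
duality, applied to an array `D k a b c = ∂_k J_{abc}` of derivatives. -/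
def jacM (D : Fin 3 → Fin 3 → Fin 3 → Fin 3 → ℝ) (k a d : Fin 3) : ℝ := D k a (d + 1) (d + 2)

/-- The flat operator `𝒟*_δ` on an array of derivatives. -/
def flatD (D : Fin 3 → Fin 3 → Fin 3 → Fin 3 → ℝ) (a c : Fin 3) : ℝ :=
  (∑ b, D b a b c) + (∑ b, D b c b a) - (2 / 3) * (∑ b, ∑ u, D b u b u) * (if a = c then 1 else 0)

/-- The flat operator `𝒬_δ` on an array of derivatives. -/
def flatQ (D : Fin 3 → Fin 3 → Fin 3 → Fin 3 → ℝ) (a : Fin 3) : ℝ :=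
  ∑ e, ∑ b, ∑ c, permSymbol e b c * D e a b c

/-- A quadratic form in the derivatives whose integral vanishes. -/
def nullForm (D : Fin 3 → Fin 3 → Fin 3 → Fin 3 → ℝ) : ℝ :=
  ∑ i, ∑ j, ∑ k,
    (2 * (jacM D i i j * jacM D k k j - jacM D k i j * jacM D i k j)
      - 2 * (jacM D i j i * jacM D k j k - jacM D k j i * jacM D i j k)
      - 3 * (jacM D i i j * jacM D k j k - jacM D k i j * jacM D i j k))

/-- The sum of the squares of all entries. -/
def sqNorm (D : Fin 3 → Fin 3 → Fin 3 → Fin 3 → ℝ) : ℝ := ∑ k, ∑ a, ∑ b, ∑ c, D k a b c ^ 2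

/-- A sum-of-squares certificate. Antisymmetry reduces `D` to `jacM D`, and the cyclic identity says
that `jacM D k` is trace-free. The null form is indispensable: the flat operator alone has a large
pointwise kernel. -/
theorem sqNorm_le_flat (D : Fin 3 → Fin 3 → Fin 3 → Fin 3 → ℝ)
    (hcyc : ∀ k a b c, D k a b c + D k c a b + D k b c a = 0)
    (hanti : ∀ k a b c, D k a b c + D k a c b = 0) :
    sqNorm D ≤ 4 * ((∑ a, ∑ c, flatD D a c ^ 2) + ∑ a, flatQ D a ^ 2 + nullForm D) := by
  have h0 : ∀ k a b, D k a b b = 0 := fun k a b => by linarith [hanti k a b b]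
  have h01 : ∀ k a, D k a 0 1 = jacM D k a 2 := fun k a => rfl
  have h12 : ∀ k a, D k a 1 2 = jacM D k a 0 := fun k a => rfl
  have h20 : ∀ k a, D k a 2 0 = jacM D k a 1 := fun k a => rfl
  have h10 : ∀ k a, D k a 1 0 = -jacM D k a 2 := fun k a => by linarith [hanti k a 0 1, h01 k a]
  have h21 : ∀ k a, D k a 2 1 = -jacM D k a 0 := fun k a => by linarith [hanti k a 1 2, h12 k a]
  have h02 : ∀ k a, D k a 0 2 = -jacM D k a 1 := fun k a => by linarith [hanti k a 2 0, h20 k a]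
  have htr : ∀ k, jacM D k 2 2 = -jacM D k 0 0 - jacM D k 1 1 := fun k => by
    linarith [hcyc k 0 1 2, h01 k 2, h12 k 0, h20 k 1]
  -- Coordinate reflections split the form into four blocks, by the index that occurs an odd number
  -- of times (or all three indices distinct). The squares come from completing squares within each
  -- block.
  have hS : (∑ a, ∑ c, flatD D a c ^ 2) + ∑ a, flatQ D a ^ 2 + nullForm D - sqNorm D / 4 =
        (3/2) * (jacM D 0 0 1 - (1/3) * jacM D 1 0 0 - jacM D 1 1 1 - jacM D 2 1 2) ^ 2 +
        (2) * (jacM D 0 1 0 - (1/4) * jacM D 1 1 1 + jacM D 2 1 2) ^ 2 +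
        (3/2) * (jacM D 0 0 2 - jacM D 1 2 1 + (2/3) * jacM D 2 0 0 + jacM D 2 1 1) ^ 2 +
        (3/2) * (jacM D 0 1 0 - (1/3) * jacM D 1 0 0 + (2/3) * jacM D 1 1 1 - jacM D 2 2 1) ^ 2 +
        (20/3) * (jacM D 1 0 0 + (1/2) * jacM D 1 1 1) ^ 2 +
        (25/24) * (jacM D 1 1 1) ^ 2 +
        (3/2) * (-jacM D 0 0 0 - (1/3) * jacM D 0 1 1 + jacM D 1 1 0 - jacM D 2 0 2) ^ 2 +
        (2) * ((-1/4) * jacM D 0 0 0 + jacM D 1 0 1 + jacM D 2 0 2) ^ 2 +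
        (27/8) * (jacM D 0 0 0 + (8/9) * jacM D 0 1 1 + (8/27) * jacM D 1 0 1 - (8/27) * jacM D 2 2 0) ^ 2 +
        (25/6) * (jacM D 0 1 1 - (1/3) * jacM D 1 0 1 + (1/3) * jacM D 2 2 0) ^ 2 +
        (20/27) * (jacM D 1 0 1 - jacM D 2 2 0) ^ 2 +
        (3/2) * (-jacM D 0 2 0 + jacM D 1 1 2 + jacM D 2 0 0 + (2/3) * jacM D 2 1 1) ^ 2 +
        (2) * (jacM D 0 2 0 + jacM D 1 2 1 + (1/4) * jacM D 2 0 0 + (1/4) * jacM D 2 1 1) ^ 2 +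
        (65/24) * (jacM D 2 0 0 - (3/13) * jacM D 2 1 1) ^ 2 +
        (100/39) * (jacM D 2 1 1) ^ 2 +
        (13/6) * (jacM D 0 1 2 + (8/13) * jacM D 0 2 1 - (4/13) * jacM D 1 0 2 + (1/13) * jacM D 1 2 0 + (1/13) * jacM D 2 0 1 - (4/13) * jacM D 2 1 0) ^ 2 +
        (35/26) * (jacM D 0 2 1 + (3/7) * jacM D 1 0 2 - (4/7) * jacM D 1 2 0 - (4/7) * jacM D 2 0 1 + (3/7) * jacM D 2 1 0) ^ 2 +
        (12/7) * (jacM D 1 0 2 + jacM D 1 2 0 - (1/6) * jacM D 2 0 1 - (1/6) * jacM D 2 1 0) ^ 2 +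
        (5/3) * (jacM D 2 0 1 + jacM D 2 1 0) ^ 2 := by
    simp only [flatD, flatQ, nullForm, sqNorm, permSymbol, Fin.sum_univ_three, h0, h01, h12, h20,
      h10, h21, h02, htr]
    simp only [Fin.isValue, Fin.val_zero, Fin.val_one, Fin.val_two, reduceIte, zero_ne_one,
      one_ne_zero, Fin.reduceEq, Nat.cast_zero, Nat.cast_one, Nat.cast_ofNat]
    ring
  have hpos : 0 ≤ (∑ a, ∑ c, flatD D a c ^ 2) + ∑ a, flatQ D a ^ 2 + nullForm D - sqNorm D / 4 := by
    rw [hS]; positivity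
  linarith

/-! ### Classical partial derivatives -/

/-- The classical partial derivative. -/
def pd (i : Fin 3) (φ : E3 → ℝ) : E3 → ℝ := fun x => fderiv ℝ φ x (EuclideanSpace.single i 1)

theorem contDiff_pd {φ : E3 → ℝ} (hφ : ContDiff ℝ ∞ φ) (i : Fin 3) : ContDiff ℝ ∞ (pd i φ) :=
  (hφ.fderiv_right (m := ∞) (by simp)).clm_apply contDiff_const

theorem hasCompactSupport_pd {φ : E3 → ℝ} (hφ : HasCompactSupport φ) (i : Fin 3) :
    HasCompactSupport (pd i φ) :=
  hφ.fderiv_apply ℝ _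

theorem pd_mul {φ ψ : E3 → ℝ} (hφ : ContDiff ℝ ∞ φ) (hψ : ContDiff ℝ ∞ ψ) (i : Fin 3) (x : E3) :
    pd i (fun x => φ x * ψ x) x = φ x * pd i ψ x + pd i φ x * ψ x := by
  have h1 := (hφ.differentiable (by simp)) x
  have h2 := (hψ.differentiable (by simp)) x
  simp only [pd]
  rw [fderiv_fun_mul h1 h2]
  simp [mul_comm]

theorem pd_comm {φ : E3 → ℝ} (hφ : ContDiff ℝ ∞ φ) (i j : Fin 3) : pd i (pd j φ) = pd j (pd i φ) := by
  funext x
  have hd : DifferentiableAt ℝ (fderiv ℝ φ) x :=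
    ((hφ.fderiv_right (m := ∞) (by simp)).differentiable (by simp)) x
  have key : ∀ v w : E3, fderiv ℝ (fun y => fderiv ℝ φ y v) x w = fderiv ℝ (fderiv ℝ φ) x w v := by
    intro v w
    rw [fderiv_clm_apply hd (differentiableAt_const v)]
    simp
  have hsymm : IsSymmSndFDerivAt ℝ φ x := by
    refine hφ.contDiffAt.isSymmSndFDerivAt ?_
    rw [minSmoothness_of_isRCLikeNormedField]
    exact WithTop.coe_le_coe.2 (le_top : (2 : ℕ∞) ≤ ⊤)
  change fderiv ℝ (fun y => fderiv ℝ φ y _) x _ = fderiv ℝ (fun y => fderiv ℝ φ y _) x _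
  rw [key, key]
  exact hsymm _ _

/-! ### Calculus of weak partial derivatives -/

theorem LocallyIntegrable.integrable_mul_test {f φ : E3 → ℝ} (hf : LocallyIntegrable f volume)
    (hφ : Continuous φ) (hc : HasCompactSupport φ) : Integrable (fun x => f x * φ x) volume := by
  simpa using hf.integrable_smul_right_of_hasCompactSupport hφ hc

theorem LocallyIntegrable.continuous_mul {f η : E3 → ℝ} (hf : LocallyIntegrable f volume)
    (hη : Continuous η) : LocallyIntegrable (fun x => η x * f x) volume := by
  rw [locallyIntegrable_iff] at hf ⊢
  exact fun K hK => (hf K hK).continuousOn_mul hη.continuousOn hK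

namespace HasWeakPartial

variable {i j : Fin 3} {f g f' g' : E3 → ℝ}

theorem integral_mul_pd (h : HasWeakPartial i f g) {φ : E3 → ℝ} (hφ : ContDiff ℝ ∞ φ)
    (hc : HasCompactSupport φ) : ∫ x, f x * pd i φ x = -∫ x, g x * φ x :=
  h.2.2 φ hφ hc

/-- The fundamental lemma of the calculus of variations. It makes `wpartial`, which is defined by
choice, interchangeable a.e. with any explicit weak derivative. -/
theorem unique (h : HasWeakPartial i f g) (h' : HasWeakPartial i f g') : g =ᵐ[volume] g' := by
  refine ae_eq_of_integral_contDiff_smul_eq h.2.1 h'.2.1 fun φ hφ hc => ?_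
  have h1 := h.2.2 φ hφ hc
  have h2 := h'.2.2 φ hφ hc
  simp only [smul_eq_mul, mul_comm (φ _)]
  linarith

theorem wpartial (h : HasWeakPartial i f g) : HasWeakPartial i f (ExtConstraint.wpartial i f) := by
  have hex : ∃ g, HasWeakPartial i f g := ⟨g, h⟩
  rw [ExtConstraint.wpartial, dif_pos hex]
  exact hex.choose_spec

theorem wpartial_ae_eq (h : HasWeakPartial i f g) : ExtConstraint.wpartial i f =ᵐ[volume] g :=
  h.wpartial.unique h

theorem congr (h : HasWeakPartial i f g) (hf : f =ᵐ[volume] f') (hg : g =ᵐ[volume] g') :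
    HasWeakPartial i f' g' := by
  refine ⟨(locallyIntegrable_congr hf).1 h.1, (locallyIntegrable_congr hg).1 h.2.1,
    fun φ hφ hc => ?_⟩
  have h1 : ∫ x, f x * pd i φ x = ∫ x, f' x * pd i φ x :=
    integral_congr_ae (hf.mono fun x hx => by simp only [hx])
  have h2 : ∫ x, g x * φ x = ∫ x, g' x * φ x :=
    integral_congr_ae (hg.mono fun x hx => by simp only [hx])
  exact h1.symm.trans ((h.2.2 φ hφ hc).trans (congrArg _ h2))

theorem add (h : HasWeakPartial i f g) (h' : HasWeakPartial i f' g') :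
    HasWeakPartial i (fun x => f x + f' x) (fun x => g x + g' x) := by
  refine ⟨h.1.add h'.1, h.2.1.add h'.2.1, fun φ hφ hc => ?_⟩
  have hc1 : Continuous (pd i φ) := (contDiff_pd hφ i).continuous
  have hs1 := hasCompactSupport_pd hc i
  simp only [add_mul]
  change ∫ x, (f x * pd i φ x + f' x * pd i φ x) = _
  rw [integral_add (LocallyIntegrable.integrable_mul_test h.1 hc1 hs1)
    (LocallyIntegrable.integrable_mul_test h'.1 hc1 hs1),
    integral_add (LocallyIntegrable.integrable_mul_test h.2.1 hφ.continuous hc)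
    (LocallyIntegrable.integrable_mul_test h'.2.1 hφ.continuous hc), h.integral_mul_pd hφ hc,
    h'.integral_mul_pd hφ hc]
  ring

theorem const_mul (h : HasWeakPartial i f g) (c : ℝ) :
    HasWeakPartial i (fun x => c * f x) (fun x => c * g x) := by
  refine ⟨LocallyIntegrable.continuous_mul h.1 continuous_const,
    LocallyIntegrable.continuous_mul h.2.1 continuous_const, fun φ hφ hc => ?_⟩
  simp only [mul_assoc]
  rw [integral_const_mul, integral_const_mul, h.2.2 φ hφ hc]
  ring

theorem sub (h : HasWeakPartial i f g) (h' : HasWeakPartial i f' g') :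
    HasWeakPartial i (fun x => f x - f' x) (fun x => g x - g' x) := by
  have := h.add (h'.const_mul (-1))
  simpa [sub_eq_add_neg] using this

/-- Test `f` against `η φ`, which is again an admissible test function. -/
theorem smooth_mul (h : HasWeakPartial i f g) {η : E3 → ℝ} (hη : ContDiff ℝ ∞ η) :
    HasWeakPartial i (fun x => η x * f x) (fun x => η x * g x + pd i η x * f x) := by
  have hd := contDiff_pd hη i
  refine ⟨LocallyIntegrable.continuous_mul h.1 hη.continuous,
    (LocallyIntegrable.continuous_mul h.2.1 hη.continuous).add
      (LocallyIntegrable.continuous_mul h.1 hd.continuous), fun φ hφ hc => ?_⟩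
  have hp : ContDiff ℝ ∞ (fun x => η x * φ x) := hη.mul hφ
  have hpc : HasCompactSupport (fun x => η x * φ x) := hc.mul_left
  have key := h.integral_mul_pd hp hpc
  have hdφ : Integrable (fun x => f x * (pd i η x * φ x)) :=
    LocallyIntegrable.integrable_mul_test h.1 (hd.continuous.mul hφ.continuous) hc.mul_left
  have hg : Integrable (fun x => g x * (η x * φ x)) :=
    LocallyIntegrable.integrable_mul_test h.2.1 hp.continuous hpc
  have hf : Integrable (fun x => f x * pd i (fun x => η x * φ x) x) :=
    LocallyIntegrable.integrable_mul_test h.1 (contDiff_pd hp i).continuous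
      (hasCompactSupport_pd hpc i)
  calc ∫ x, η x * f x * pd i φ x
      = ∫ x, (f x * pd i (fun x => η x * φ x) x - f x * (pd i η x * φ x)) := by
        congr 1; funext x; rw [pd_mul hη hφ]; ring
    _ = -∫ x, (g x * (η x * φ x) + f x * (pd i η x * φ x)) := by
        rw [integral_sub hf hdφ, integral_add hg hdφ, key]; ring
    _ = -∫ x, (η x * g x + pd i η x * f x) * φ x := by
        congr 2; funext x; ring

/-- Weak partial derivatives commute. -/
theorem comm {fi fj fij fji : E3 → ℝ} (hi : HasWeakPartial i f fi) (hij : HasWeakPartial j fi fij)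
    (hj : HasWeakPartial j f fj) (hji : HasWeakPartial i fj fji) : fij =ᵐ[volume] fji := by
  refine ae_eq_of_integral_contDiff_smul_eq hij.2.1 hji.2.1 fun φ hφ hc => ?_
  have h1 := hij.integral_mul_pd hφ hc
  have h2 := hi.integral_mul_pd (contDiff_pd hφ j) (hasCompactSupport_pd hc j)
  have h3 := hji.integral_mul_pd hφ hc
  have h4 := hj.integral_mul_pd (contDiff_pd hφ i) (hasCompactSupport_pd hc i)
  rw [pd_comm hφ i j] at h2
  simp only [smul_eq_mul, mul_comm (φ _)]
  linarith

end HasWeakPartial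

/-! ### Mollification -/

/-- The mollification of `f` by a normed bump function. -/
def mollify (ρ : ContDiffBump (0 : E3)) (f : E3 → ℝ) : E3 → ℝ :=
  ρ.normed volume ⋆[lsmul ℝ ℝ, volume] f

theorem mollify_apply (ρ : ContDiffBump (0 : E3)) (f : E3 → ℝ) (x : E3) :
    mollify ρ f x = ∫ y, f y * ρ.normed volume (x - y) := by
  rw [mollify, convolution_lsmul_swap]
  simp [mul_comm]

theorem contDiff_mollify (ρ : ContDiffBump (0 : E3)) {f : E3 → ℝ}
    (hf : LocallyIntegrable f volume) : ContDiff ℝ ∞ (mollify ρ f) :=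
  ρ.hasCompactSupport_normed.contDiff_convolution_left _ ρ.contDiff_normed hf

theorem hasCompactSupport_mollify (ρ : ContDiffBump (0 : E3)) {f : E3 → ℝ}
    (hf : HasCompactSupport f) : HasCompactSupport (mollify ρ f) :=
  ρ.hasCompactSupport_normed.convolution _ hf

/-- The derivative falls on the kernel, and `y ↦ ρ(x - y)` is a test function. The sign from the
reflection cancels the one in the definition of the weak derivative. -/
theorem pd_mollify (ρ : ContDiffBump (0 : E3)) {i : Fin 3} {f g : E3 → ℝ}
    (h : HasWeakPartial i f g) : pd i (mollify ρ f) = mollify ρ g := by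
  funext x
  have hρ : ContDiff ℝ ∞ (ρ.normed (volume : Measure E3)) := ρ.contDiff_normed
  have hd := (ρ.hasCompactSupport_normed (μ := (volume : Measure E3))).hasFDerivAt_convolution_left
    (lsmul ℝ ℝ) (hρ.of_le (by simp)) h.1 x
  have hex : ConvolutionExistsAt (fderiv ℝ (ρ.normed (volume : Measure E3))) f x
      ((lsmul ℝ ℝ : ℝ →L[ℝ] ℝ →L[ℝ] ℝ).precompL E3) volume :=
    (ρ.hasCompactSupport_normed.fderiv ℝ).convolutionExists_left _
      (hρ.continuous_fderiv (by simp)) h.1 x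
  set φ : E3 → ℝ := fun y => ρ.normed volume (x - y) with hφdef
  have hφ : ContDiff ℝ ∞ φ := hρ.comp (contDiff_const.sub contDiff_id)
  have hφc : HasCompactSupport φ :=
    ρ.hasCompactSupport_normed.comp_homeomorph (Homeomorph.subLeft x)
  have hpdφ : ∀ y, pd i φ y = -pd i (ρ.normed volume) (x - y) := by
    intro y
    have h1 : HasFDerivAt (fun y : E3 => x - y) (-(ContinuousLinearMap.id ℝ E3)) y := by
      simpa using (hasFDerivAt_id y).const_sub x
    have h2 : HasFDerivAt φ _ y := ((hρ.differentiable (by simp)) (x - y)).hasFDerivAt.comp y h1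
    simp only [pd, h2.fderiv]
    simp
  rw [mollify_apply]
  have h1 := h.integral_mul_pd hφ hφc
  have h2 : pd i (mollify ρ f) x = ∫ y, f y * pd i (ρ.normed volume) (x - y) := by
    rw [pd, mollify, hd.fderiv, convolution_eq_swap, integral_apply]
    · simp [pd, mul_comm]
    · exact hex.integrable_swap
  rw [h2, ← neg_eq_iff_eq_neg.2 h1, ← integral_neg]
  congr 1; funext y; rw [hpdφ]; ring

/-- A sequence of bump functions that shrinks to the origin. -/
def bumpSeq (n : ℕ) : ContDiffBump (0 : E3) where
  rIn := 1 / (n + 1)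
  rOut := 2 / (n + 1)
  rIn_pos := by positivity
  rIn_lt_rOut := by gcongr; norm_num

theorem tendsto_mollify_bumpSeq {f : E3 → ℝ} (hf : LocallyIntegrable f volume) :
    ∀ᵐ x, Tendsto (fun n => mollify (bumpSeq n) f x) atTop (𝓝 (f x)) := by
  -- Lebesgue differentiation needs a bounded ratio of outer to inner radius; for `bumpSeq` it is
  -- exactly `2`.
  refine ContDiffBump.ae_convolution_tendsto_right_of_locallyIntegrable (K := 2) ?_ ?_ hf
  · exact tendsto_const_div_atTop_nhds_zero_nat 2 |>.comp (tendsto_add_atTop_nat 1) |>.congr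
      fun n => by simp [bumpSeq]
  · exact Eventually.of_forall fun n => by simp only [bumpSeq]; apply le_of_eq; ring

/-! ### The weight function -/

theorem one_le_weight (x : E3) : 1 ≤ weight x := by
  rw [weight, Real.one_le_sqrt]; nlinarith [sq_nonneg ‖x‖]

theorem weight_pos (x : E3) : 0 < weight x := zero_lt_one.trans_le (one_le_weight x)

theorem weight_sq (x : E3) : weight x ^ 2 = 1 + ‖x‖ ^ 2 := Real.sq_sqrt (by positivity)

theorem norm_le_weight (x : E3) : ‖x‖ ≤ weight x :=
  Real.le_sqrt_of_sq_le (by linarith)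

theorem abs_apply_le_weight (x : E3) (i : Fin 3) : |x i| ≤ weight x :=
  (by simpa using PiLp.norm_apply_le x i : |x i| ≤ ‖x‖).trans (norm_le_weight x)

theorem weight_rpow_eq (x : E3) (p : ℝ) : weight x ^ p = (1 + ‖x‖ ^ 2) ^ (p / 2) := by
  rw [weight, Real.sqrt_eq_rpow, ← Real.rpow_mul (by positivity)]
  ring_nf

theorem contDiff_weight_rpow (p : ℝ) : ContDiff ℝ ∞ (fun x => weight x ^ p) := by
  simp_rw [weight_rpow_eq]
  exact (contDiff_const.add (contDiff_norm_sq ℝ)).rpow_const_of_ne fun x => by positivity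

theorem pd_weight_rpow (p : ℝ) (i : Fin 3) :
    pd i (fun x => weight x ^ p) = fun x => p * (x i * weight x ^ (p - 2)) := by
  funext x
  simp_rw [weight_rpow_eq]
  have h1 : HasFDerivAt (fun y : E3 => 1 + ‖y‖ ^ 2) (2 • innerSL ℝ x) x :=
    ((hasStrictFDerivAt_norm_sq x).hasFDerivAt).const_add 1
  have h2 := h1.rpow_const (p := p / 2) (Or.inl (by positivity))
  rw [pd, h2.fderiv]
  simp only [smul_apply, innerSL_apply_apply,
    EuclideanSpace.inner_single_right, smul_eq_mul, nsmul_eq_mul]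
  rw [show p / 2 - 1 = (p - 2) / 2 by ring]
  simp
  ring

/-! ### Smooth functions with symbol estimates -/

/-- `η` is smooth and its derivatives of order `j ≤ n` are bounded by `C σ^{a-j}`. -/
def IsSymbol : ℕ → ℝ → ℝ → (E3 → ℝ) → Prop
  | 0, a, C, η => ContDiff ℝ ∞ η ∧ ∀ x, |η x| ≤ C * weight x ^ a
  | n + 1, a, C, η => (ContDiff ℝ ∞ η ∧ ∀ x, |η x| ≤ C * weight x ^ a) ∧
      ∀ i, IsSymbol n (a - 1) C (pd i η)

namespace IsSymbol

variable {n : ℕ} {a b C D : ℝ} {η ζ : E3 → ℝ}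

theorem base (h : IsSymbol n a C η) : ContDiff ℝ ∞ η ∧ ∀ x, |η x| ≤ C * weight x ^ a := by
  cases n with
  | zero => exact h
  | succ n => exact h.1

theorem contDiff (h : IsSymbol n a C η) : ContDiff ℝ ∞ η := h.base.1

theorem abs_le (h : IsSymbol n a C η) (x : E3) : |η x| ≤ C * weight x ^ a := h.base.2 x

theorem const_nonneg (h : IsSymbol n a C η) : 0 ≤ C := by
  have h1 := (abs_nonneg _).trans (h.abs_le 0)
  exact nonneg_of_mul_nonneg_left h1 (Real.rpow_pos_of_pos (weight_pos 0) a)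

theorem of_succ (h : IsSymbol (n + 1) a C η) : IsSymbol n a C η := by
  induction n generalizing a η with
  | zero => exact h.1
  | succ n ih => exact ⟨h.1, fun i => ih (h.2 i)⟩

theorem mono (h : IsSymbol n a C η) (hCD : C ≤ D) : IsSymbol n a D η := by
  have hb : ContDiff ℝ ∞ η ∧ ∀ x, |η x| ≤ D * weight x ^ a :=
    ⟨h.contDiff, fun x => (h.abs_le x).trans
      (mul_le_mul_of_nonneg_right hCD (Real.rpow_nonneg (weight_pos x).le a))⟩
  induction n generalizing a η with
  | zero => exact hb
  | succ n ih =>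
    refine ⟨hb, fun i => ih (h.2 i) ⟨(h.2 i).contDiff, fun x => ((h.2 i).abs_le x).trans
      (mul_le_mul_of_nonneg_right hCD (Real.rpow_nonneg (weight_pos x).le _))⟩⟩

theorem add (h : IsSymbol n a C η) (h' : IsSymbol n a D ζ) :
    IsSymbol n a (C + D) (fun x => η x + ζ x) := by
  have hb : ContDiff ℝ ∞ (fun x => η x + ζ x) ∧ ∀ x, |η x + ζ x| ≤ (C + D) * weight x ^ a :=
    ⟨h.contDiff.add h'.contDiff, fun x => (abs_add_le _ _).trans
      (by rw [add_mul]; exact add_le_add (h.abs_le x) (h'.abs_le x))⟩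
  induction n generalizing a η ζ with
  | zero => exact hb
  | succ n ih =>
    refine ⟨hb, fun i => ?_⟩
    have he : pd i (fun x => η x + ζ x) = fun x => pd i η x + pd i ζ x := by
      funext x
      simp only [pd]
      rw [fderiv_fun_add ((h.contDiff.differentiable (by simp)) x)
        ((h'.contDiff.differentiable (by simp)) x)]
      simp
    rw [he]
    refine ih (h.2 i) (h'.2 i) ⟨(h.2 i).contDiff.add (h'.2 i).contDiff, fun x =>
      (abs_add_le _ _).trans ?_⟩
    rw [add_mul]
    exact add_le_add ((h.2 i).abs_le x) ((h'.2 i).abs_le x)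

/-- Orders add under products; the factor `2 ^ n` counts the terms of Leibniz's rule. -/
theorem mul (h : IsSymbol n a C η) (h' : IsSymbol n b D ζ) :
    IsSymbol n (a + b) (2 ^ n * (C * D)) (fun x => η x * ζ x) := by
  have key : ∀ {m : ℕ} {a b : ℝ} {η ζ : E3 → ℝ}, IsSymbol m a C η → IsSymbol m b D ζ →
      ∀ x, |η x * ζ x| ≤ C * D * weight x ^ (a + b) := by
    intro m a b η ζ h h' x
    rw [abs_mul, Real.rpow_add (weight_pos x)]
    calc |η x| * |ζ x| ≤ (C * weight x ^ a) * (D * weight x ^ b) :=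
          mul_le_mul (h.abs_le x) (h'.abs_le x) (abs_nonneg _) ((abs_nonneg _).trans (h.abs_le x))
      _ = _ := by ring
  have hCD : 0 ≤ C * D := mul_nonneg h.const_nonneg h'.const_nonneg
  induction n generalizing a b η ζ with
  | zero => exact ⟨h.contDiff.mul h'.contDiff, by simpa using key h h'⟩
  | succ n ih =>
    refine ⟨⟨h.contDiff.mul h'.contDiff, fun x => (key h h' x).trans ?_⟩, fun i => ?_⟩
    · refine mul_le_mul_of_nonneg_right ?_ (Real.rpow_nonneg (weight_pos x).le _)
      exact le_mul_of_one_le_left hCD (one_le_pow₀ one_le_two)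
    · have he : pd i (fun x => η x * ζ x) = fun x => η x * pd i ζ x + pd i η x * ζ x := by
        funext x; exact pd_mul h.contDiff h'.contDiff i x
      rw [he]
      have h1 := ih h.of_succ (h'.2 i)
      have h2 := ih (h.2 i) h'.of_succ
      rw [show a + (b - 1) = a + b - 1 by ring] at h1
      rw [show a - 1 + b = a + b - 1 by ring] at h2
      exact (h1.add h2).mono (le_of_eq (by ring))

theorem zero (n : ℕ) (a : ℝ) : IsSymbol n a 0 (fun _ => 0) := by
  induction n generalizing a with
  | zero => exact ⟨contDiff_const, by simp⟩
  | succ n ih =>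
    refine ⟨⟨contDiff_const, by simp⟩, fun i => ?_⟩
    have he : pd i (fun _ => (0 : ℝ)) = fun _ => 0 := by funext x; simp [pd]
    rw [he]; exact ih _

theorem const (n : ℕ) (c : ℝ) : IsSymbol n 0 |c| (fun _ => c) := by
  cases n with
  | zero => exact ⟨contDiff_const, by simp⟩
  | succ n =>
    refine ⟨⟨contDiff_const, by simp⟩, fun i => ?_⟩
    have he : pd i (fun _ => c) = fun _ => 0 := by funext x; simp [pd]
    rw [he]; exact (zero _ _).mono (abs_nonneg c)

theorem coord (n : ℕ) (i : Fin 3) : IsSymbol n 1 1 (fun x => x i) := by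
  have hb : ContDiff ℝ ∞ (fun x : E3 => x i) ∧ ∀ x : E3, |x i| ≤ 1 * weight x ^ (1 : ℝ) :=
    ⟨by fun_prop, fun x => by simpa using abs_apply_le_weight x i⟩
  cases n with
  | zero => exact hb
  | succ n =>
    refine ⟨hb, fun j => ?_⟩
    have he : pd j (fun x => x i) = fun _ => (EuclideanSpace.single j (1 : ℝ) : E3) i := by
      funext x
      have : HasFDerivAt (fun x : E3 => x i) (EuclideanSpace.proj i : E3 →L[ℝ] ℝ) x :=
        (EuclideanSpace.proj i : E3 →L[ℝ] ℝ).hasFDerivAt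
      simp [pd, this.fderiv]
    rw [he, sub_self]
    refine (const n _).mono ?_
    rw [PiLp.single_apply]; split_ifs <;> simp

/-- The derivative `p xᵢ σ^{p-2}` is a product of symbols of total order `p - 1`, so the induction
closes when `p` is left free. -/
theorem weight_rpow (n : ℕ) (p : ℝ) : ∃ C, IsSymbol n p C (fun x => weight x ^ p) := by
  have hb : ∀ p : ℝ, ∀ x, |weight x ^ p| ≤ 1 * weight x ^ p := fun p x => by
    rw [abs_of_nonneg (Real.rpow_nonneg (weight_pos x).le p), one_mul]
  induction n generalizing p with
  | zero => exact ⟨1, contDiff_weight_rpow p, hb p⟩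
  | succ n ih =>
    obtain ⟨C, hC⟩ := ih (p - 2)
    have h1 := (const n p).mul ((coord n 0).mul hC)
    set B := 2 ^ n * (|p| * (2 ^ n * (1 * C)))
    refine ⟨max 1 B, ⟨contDiff_weight_rpow p, fun x => (hb p x).trans ?_⟩, fun i => ?_⟩
    · exact mul_le_mul_of_nonneg_right (le_max_left _ _) (Real.rpow_nonneg (weight_pos x).le _)
    · rw [pd_weight_rpow]
      have h2 := (const n p).mul ((coord n i).mul hC)
      rw [show 0 + (1 + (p - 2)) = p - 1 by ring] at h2
      exact h2.mono (le_max_right _ _)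

/-- Where `θ(x/R) ≠ 0` one has `|x| ≤ 2R`, hence `σ ≤ 3R` because `R ≥ 1`. So powers of `R⁻¹` may be
traded for powers of `σ⁻¹`, uniformly in `R`. -/
theorem dilate_bound {θ : E3 → ℝ} (hθ : ContDiff ℝ ∞ θ) (hs : tsupport θ ⊆ closedBall 0 2)
    (j : ℕ) : ∃ B, ∀ R : ℝ, 1 ≤ R → ContDiff ℝ ∞ (fun x => (R⁻¹) ^ j * θ (R⁻¹ • x)) ∧
      ∀ x, |(R⁻¹) ^ j * θ (R⁻¹ • x)| ≤ B * weight x ^ (-(j : ℝ)) := by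
  have hc : HasCompactSupport θ := HasCompactSupport.of_support_subset_isCompact
    (isCompact_closedBall (0 : E3) 2) ((subset_tsupport θ).trans hs)
  obtain ⟨B, hB⟩ := hc.exists_bound_of_continuous hθ.continuous
  refine ⟨3 ^ j * B, fun R hR => ⟨contDiff_const.mul (hθ.comp (contDiff_const_smul _)),
    fun x => ?_⟩⟩
  have hR0 : 0 < R := by linarith
  have hw := weight_pos x
  have hB0 : 0 ≤ B := (norm_nonneg _).trans (hB 0)
  rw [Real.rpow_neg hw.le, Real.rpow_natCast, abs_mul, abs_of_nonneg (by positivity)]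
  by_cases hx : θ (R⁻¹ • x) = 0
  · rw [hx]; simp; positivity
  · have h1 : R⁻¹ • x ∈ closedBall (0 : E3) 2 := hs (subset_tsupport θ hx)
    rw [mem_closedBall_zero_iff, norm_smul, Real.norm_of_nonneg (by positivity)] at h1
    have h2 : ‖x‖ ≤ 2 * R := by
      rw [inv_mul_le_iff₀ hR0] at h1; linarith
    have h3 : weight x ≤ 3 * R := by
      rw [weight]
      refine Real.sqrt_le_iff.2 ⟨by positivity, ?_⟩
      nlinarith [norm_nonneg x]
    have h4 : R⁻¹ ^ j ≤ 3 ^ j * (weight x ^ j)⁻¹ := by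
      rw [← inv_pow, ← mul_pow]
      refine pow_le_pow_left₀ (by positivity) ?_ j
      rw [← div_eq_mul_inv, le_div_iff₀ hw, inv_mul_le_iff₀ hR0]
      linarith
    calc R⁻¹ ^ j * |θ (R⁻¹ • x)| ≤ (3 ^ j * (weight x ^ j)⁻¹) * B :=
          mul_le_mul h4 (hB _) (abs_nonneg _) (by positivity)
      _ = _ := by ring

/-- The exponent `j` is there for the induction: differentiating `R⁻ʲ θ(x/R)` gives the same
expression with `j + 1` and `∂θ`. -/
theorem dilate (n : ℕ) {θ : E3 → ℝ} (hθ : ContDiff ℝ ∞ θ)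
    (hs : tsupport θ ⊆ closedBall 0 2) (j : ℕ) :
    ∃ C, ∀ R : ℝ, 1 ≤ R → IsSymbol n (-j) C (fun x => (R⁻¹) ^ j * θ (R⁻¹ • x)) := by
  induction n generalizing θ j with
  | zero => exact dilate_bound hθ hs j
  | succ n ih =>
    obtain ⟨B, hB⟩ := dilate_bound hθ hs j
    have hpd : ∀ i, tsupport (pd i θ) ⊆ closedBall 0 2 := fun i =>
      (tsupport_fderiv_apply_subset ℝ _).trans hs
    have hi := fun i => ih (contDiff_pd hθ i) (hpd i) (j + 1)
    choose C hC using hi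
    refine ⟨|B| + ∑ i, |C i|, fun R hR => ⟨⟨(hB R hR).1, fun x => ((hB R hR).2 x).trans ?_⟩,
      fun i => ?_⟩⟩
    · refine mul_le_mul_of_nonneg_right ?_ (Real.rpow_nonneg (weight_pos x).le _)
      exact (le_abs_self B).trans (le_add_of_nonneg_right (Finset.sum_nonneg fun i _ => abs_nonneg _))
    · have he : pd i (fun x => (R⁻¹) ^ j * θ (R⁻¹ • x)) =
          fun x => (R⁻¹) ^ (j + 1) * pd i θ (R⁻¹ • x) := by
        funext x
        have h1 : HasFDerivAt (fun x : E3 => R⁻¹ • x) (R⁻¹ • ContinuousLinearMap.id ℝ E3) x :=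
          (hasFDerivAt_id x).const_smul R⁻¹
        have h2 := (((hθ.differentiable (by simp)) (R⁻¹ • x)).hasFDerivAt.comp x h1).const_mul
          ((R⁻¹) ^ j)
        have h3 : fderiv ℝ (fun x => (R⁻¹) ^ j * θ (R⁻¹ • x)) x = _ := h2.fderiv
        simp only [pd, h3]
        simp
        ring
      rw [he]
      have h1 := hC i R hR
      rw [show -((j + 1 : ℕ) : ℝ) = -(j : ℝ) - 1 by push_cast; ring] at h1
      refine h1.mono ((le_abs_self _).trans ?_)
      exact (Finset.single_le_sum (f := fun i => |C i|) (fun i _ => abs_nonneg _)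
        (Finset.mem_univ i)).trans (le_add_of_nonneg_left (abs_nonneg B))

end IsSymbol

/-! ### Cutoff functions -/

/-- A smooth function that is `1` on the unit ball and `0` outside of the ball of radius `2`. -/
def unitBump : ContDiffBump (0 : E3) := ⟨1, 2, one_pos, one_lt_two⟩

/-- Smooth cutoff functions at the scale `R`. -/
def cutoff (R : ℝ) (x : E3) : ℝ := unitBump (R⁻¹ • x)

theorem contDiff_cutoff (R : ℝ) : ContDiff ℝ ∞ (cutoff R) :=
  unitBump.contDiff.comp (contDiff_const_smul _)

theorem exists_isSymbol_cutoff (n : ℕ) : ∃ C, ∀ R : ℝ, 1 ≤ R → IsSymbol n 0 C (cutoff R) := by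
  have := IsSymbol.dilate n (unitBump.contDiff) unitBump.tsupport_eq.subset 0
  simp only [pow_zero, one_mul, Nat.cast_zero, neg_zero] at this
  exact this

theorem hasCompactSupport_cutoff {R : ℝ} (hR : 0 < R) : HasCompactSupport (cutoff R) :=
  unitBump.hasCompactSupport.comp_homeomorph (Homeomorph.smulOfNeZero R⁻¹ (inv_ne_zero hR.ne'))

theorem cutoff_eq_one {R : ℝ} (hR : 0 < R) {x : E3} (hx : ‖x‖ ≤ R) : cutoff R x = 1 := by
  apply unitBump.one_of_mem_closedBall
  rw [mem_closedBall_zero_iff, norm_smul, Real.norm_of_nonneg (by positivity),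
    inv_mul_le_iff₀ hR]
  simpa [unitBump] using hx

/-! ### A pointwise bound by the integral of a mixed third derivative -/

/-- The fundamental theorem of calculus along one coordinate direction. -/
theorem enorm_le_lmarginal_pd {φ : E3 → ℝ} (hφ : ContDiff ℝ ∞ φ) (hc : HasCompactSupport φ)
    (i : Fin 3) : (fun z : Fin 3 → ℝ => ‖φ (WithLp.toLp 2 z)‖ₑ) ≤
      ∫⋯∫⁻_{i}, (fun z => ‖pd i φ (WithLp.toLp 2 z)‖ₑ) ∂fun _ => volume := by
  intro z
  rw [lmarginal_singleton]
  set L : ℝ → E3 := fun t => WithLp.toLp 2 (Function.update z i t) with hL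
  have hLd : ∀ t, HasDerivAt L (EuclideanSpace.single i 1) t := fun t =>
    ((EuclideanSpace.equiv (Fin 3) ℝ).symm.hasFDerivAt.comp_hasDerivAt t
      (hasDerivAt_update z i t))
  have hLc : ContDiff ℝ 1 L :=
    (EuclideanSpace.equiv (Fin 3) ℝ).symm.contDiff.comp (contDiff_update 1 z i)
  have hLe : IsClosedEmbedding L :=
    (EuclideanSpace.equiv (Fin 3) ℝ).symm.toHomeomorph.isClosedEmbedding.comp
      (isClosedEmbedding_update z i)
  calc ‖φ (WithLp.toLp 2 z)‖ₑ = ‖(φ ∘ L) (z i)‖ₑ := by simp [hL]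
    _ ≤ ∫⁻ y in Set.Iic (z i), ‖deriv (φ ∘ L) y‖ₑ :=
        HasCompactSupport.enorm_le_lintegral_Ici_deriv ((hφ.of_le (by simp)).comp hLc)
          (hc.comp_isClosedEmbedding hLe) _
    _ ≤ ∫⁻ y, ‖deriv (φ ∘ L) y‖ₑ := lintegral_mono' Measure.restrict_le_self le_rfl
    _ = ∫⁻ t, ‖pd i φ (WithLp.toLp 2 (Function.update z i t))‖ₑ := by
        refine lintegral_congr fun t => ?_
        rw [(((hφ.differentiable (by simp)) (L t)).hasFDerivAt.comp_hasDerivAt t (hLd t)).deriv]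
        rfl

/-- The one-dimensional bound is applied in each coordinate direction in turn; Tonelli merges the
three marginal integrals into one over the whole space. -/
theorem enorm_le_lintegral_pd_pd_pd {u : E3 → ℝ} (hu : ContDiff ℝ ∞ u) (hc : HasCompactSupport u)
    (x : E3) : ‖u x‖ₑ ≤ ∫⁻ y, ‖pd 2 (pd 1 (pd 0 u)) y‖ₑ := by
  have h0 := enorm_le_lmarginal_pd hu hc 0
  have h1 := enorm_le_lmarginal_pd (contDiff_pd hu 0) (hasCompactSupport_pd hc 0) 1
  have h2 := enorm_le_lmarginal_pd (contDiff_pd (contDiff_pd hu 0) 1)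
    (hasCompactSupport_pd (hasCompactSupport_pd hc 0) 1) 2
  set G : (Fin 3 → ℝ) → ℝ≥0∞ := fun z => ‖pd 2 (pd 1 (pd 0 u)) (WithLp.toLp 2 z)‖ₑ with hG
  have hcont : Continuous (pd 2 (pd 1 (pd 0 u))) :=
    (contDiff_pd (contDiff_pd (contDiff_pd hu 0) 1) 2).continuous
  have hGm : Measurable G :=
    (hcont.comp (PiLp.continuous_toLp 2 _)).enorm.measurable
  have key := h0.trans (lmarginal_mono (h1.trans (lmarginal_mono h2)))
  rw [← lmarginal_union _ G hGm (by decide),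
    ← lmarginal_union _ G hGm (by decide)] at key
  have hun : ({0} ∪ ({1} ∪ {2}) : Finset (Fin 3)) = Finset.univ := by decide
  rw [hun] at key
  have h3 := key (WithLp.ofLp x)
  rw [lmarginal_univ] at h3
  refine h3.trans (le_of_eq ?_)
  exact (PiLp.volume_preserving_toLp (Fin 3)).lintegral_comp hcont.enorm.measurable

/-! ### The third-derivative bound for weak derivatives -/

/-- `g` is the iterated weak derivative of `f` along the list `s`, the head of the list first. -/
def HasIterWeak : List (Fin 3) → (E3 → ℝ) → (E3 → ℝ) → Prop
  | [], f, g => f = g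
  | i :: s, f, g => ∃ f', HasWeakPartial i f f' ∧ HasIterWeak s f' g

theorem HasIterWeak.add {s : List (Fin 3)} {f g f' g' : E3 → ℝ} (h : HasIterWeak s f g)
    (h' : HasIterWeak s f' g') : HasIterWeak s (fun x => f x + f' x) (fun x => g x + g' x) := by
  induction s generalizing f f' with
  | nil => rw [show f = g from h, show f' = g' from h']; rfl
  | cons i s ih =>
    obtain ⟨f₁, h1, h2⟩ := h
    obtain ⟨f₁', h1', h2'⟩ := h'
    exact ⟨_, h1.add h1', ih h2 h2'⟩

theorem lintegral_enorm_mollify_le (ρ : ContDiffBump (0 : E3)) {f : E3 → ℝ}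
    (hf : AEStronglyMeasurable f volume) : ∫⁻ x, ‖mollify ρ f x‖ₑ ≤ ∫⁻ x, ‖f x‖ₑ := by
  have hρc : Continuous (ρ.normed (volume : Measure E3)) := ρ.continuous_normed
  calc ∫⁻ x, ‖mollify ρ f x‖ₑ
      ≤ ∫⁻ x, ∫⁻ y, ‖f y‖ₑ * ‖ρ.normed volume (x - y)‖ₑ := by
        refine lintegral_mono fun x => ?_
        rw [mollify_apply]
        refine (enorm_integral_le_lintegral_enorm _).trans (le_of_eq ?_)
        simp_rw [enorm_mul]
    _ = ∫⁻ y, ∫⁻ x, ‖f y‖ₑ * ‖ρ.normed volume (x - y)‖ₑ := by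
        refine lintegral_lintegral_swap ?_
        refine AEMeasurable.mul (hf.enorm.comp_quasiMeasurePreserving
          Measure.quasiMeasurePreserving_snd) ?_
        exact (hρc.comp (continuous_fst.sub continuous_snd)).enorm.measurable.aemeasurable
    _ = ∫⁻ y, ‖f y‖ₑ := by
        refine lintegral_congr fun y => ?_
        rw [lintegral_const_mul' _ _ enorm_ne_top,
          lintegral_sub_right_eq_self (fun x => ‖ρ.normed volume x‖ₑ) y]
        have : ∫⁻ x, ‖ρ.normed (volume : Measure E3) x‖ₑ = 1 := by
          have h1 := ρ.integral_normed (μ := (volume : Measure E3))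
          rw [← ofReal_integral_norm_eq_lintegral_enorm ρ.integrable_normed]
          simp_rw [Real.norm_of_nonneg (ρ.nonneg_normed _), h1, ENNReal.ofReal_one]
        rw [this, mul_one]

/-- A compactly supported function is bounded by the `L¹` norm of its mixed third derivative. -/
theorem HasIterWeak.ae_enorm_le {f g : E3 → ℝ} (hf : HasCompactSupport f)
    (h : HasIterWeak [0, 1, 2] f g) : ∀ᵐ x, ‖f x‖ₑ ≤ ∫⁻ y, ‖g y‖ₑ := by
  obtain ⟨f₀, h0, f₁, h1, f₂, h2, rfl⟩ := h
  filter_upwards [tendsto_mollify_bumpSeq h0.1] with x hx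
  -- The classical bound holds for each mollification, and mollifying does not increase the `L¹`
  -- norm of the third derivative, so the bound survives the limit.
  refine le_of_tendsto hx.enorm (Eventually.of_forall fun n => ?_)
  refine (enorm_le_lintegral_pd_pd_pd (contDiff_mollify _ h0.1)
    (hasCompactSupport_mollify _ hf) x).trans ?_
  rw [pd_mollify _ h0, pd_mollify _ h1, pd_mollify _ h2]
  exact lintegral_enorm_mollify_le _ h2.2.1.aestronglyMeasurable

/-! ### Weighted integral bounds and the weighted Sobolev embedding -/

/-- The weak derivatives of `f` of order `j ≤ n` have `L¹` norms at most `K` with the weights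
`σ^{a+j}`. -/
def HasWeightedL1 : ℕ → ℝ → ℝ≥0∞ → (E3 → ℝ) → Prop
  | 0, a, K, f => ∫⁻ x, ‖f x‖ₑ * ENNReal.ofReal (weight x ^ a) ≤ K
  | n + 1, a, K, f => (∫⁻ x, ‖f x‖ₑ * ENNReal.ofReal (weight x ^ a) ≤ K) ∧
      ∀ i, ∃ g, HasWeakPartial i f g ∧ HasWeightedL1 n (a + 1) K g

theorem HasWeightedL1.of_succ {n : ℕ} {a : ℝ} {K : ℝ≥0∞} {f : E3 → ℝ}
    (h : HasWeightedL1 (n + 1) a K f) : HasWeightedL1 n a K f := by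
  induction n generalizing a f with
  | zero => exact h.1
  | succ n ih =>
    refine ⟨h.1, fun i => ?_⟩
    obtain ⟨g, hg, hg'⟩ := h.2 i
    exact ⟨g, hg, ih hg'⟩

/-- Leibniz's rule. A derivative on `η` lowers `a` by one, a derivative on `f` raises `b` by one;
either way `b = a - s.length` persists for the shorter list. At the end the two weights match in
each of the `2 ^ s.length` terms. -/
theorem HasWeightedL1.symbol_mul {s : List (Fin 3)} {a b C : ℝ} {K : ℝ≥0∞} {η f : E3 → ℝ}
    (hη : IsSymbol s.length a C η) (hf : HasWeightedL1 s.length b K f) (hb : b = a - s.length)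
    (hfm : AEStronglyMeasurable f volume) :
    ∃ g, HasIterWeak s (fun x => η x * f x) g ∧ AEStronglyMeasurable g volume ∧
      ∫⁻ x, ‖g x‖ₑ ≤ 2 ^ s.length * (ENNReal.ofReal C * K) := by
  induction s generalizing a b η f with
  | nil =>
    refine ⟨_, rfl, hη.contDiff.continuous.aestronglyMeasurable.mul hfm, ?_⟩
    simp only [List.length_nil, CharP.cast_eq_zero, sub_zero] at hb
    subst hb
    simp only [List.length_nil, pow_zero, one_mul]
    calc ∫⁻ x, ‖η x * f x‖ₑ
        ≤ ∫⁻ x, ENNReal.ofReal C * (‖f x‖ₑ * ENNReal.ofReal (weight x ^ b)) := by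
          refine lintegral_mono fun x => ?_
          rw [enorm_mul, mul_left_comm, mul_comm]
          gcongr
          rw [← ENNReal.ofReal_mul hη.const_nonneg, Real.enorm_eq_ofReal_abs]
          exact ENNReal.ofReal_le_ofReal (hη.abs_le x)
      _ ≤ ENNReal.ofReal C * K := by
          rw [lintegral_const_mul' _ _ ENNReal.ofReal_ne_top]
          gcongr
          exact hf
  | cons i s ih =>
    obtain ⟨f', hf', hw⟩ := hf.2 i
    simp only [List.length_cons, Nat.cast_add, Nat.cast_one] at hb
    obtain ⟨g₁, h1, m1, b1⟩ := ih hη.of_succ hw (by rw [hb]; ring) hf'.2.1.aestronglyMeasurable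
    obtain ⟨g₂, h2, m2, b2⟩ := ih (hη.2 i) hf.of_succ (by rw [hb]; ring) hfm
    refine ⟨_, ⟨_, hf'.smooth_mul hη.contDiff, h1.add h2⟩, m1.add m2, ?_⟩
    calc ∫⁻ x, ‖g₁ x + g₂ x‖ₑ ≤ ∫⁻ x, (‖g₁ x‖ₑ + ‖g₂ x‖ₑ) := lintegral_mono fun x => enorm_add_le _ _
      _ = (∫⁻ x, ‖g₁ x‖ₑ) + ∫⁻ x, ‖g₂ x‖ₑ := lintegral_add_left' m1.enorm _
      _ ≤ _ := by
        refine (add_le_add b1 b2).trans (le_of_eq ?_)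
        rw [List.length_cons, pow_succ]; ring

/-- The weighted embedding: three weak derivatives in weighted `L¹` spaces give a weighted pointwise
bound. -/
theorem HasWeightedL1.exists_ae_bound (a : ℝ) : ∃ C : ℝ, 0 ≤ C ∧ ∀ (f : E3 → ℝ) (K : ℝ≥0∞),
    AEStronglyMeasurable f volume → HasWeightedL1 3 (a - 3) K f →
      ∀ᵐ x, ENNReal.ofReal (weight x ^ a) * ‖f x‖ₑ ≤ ENNReal.ofReal C * K := by
  obtain ⟨A, hA⟩ := IsSymbol.weight_rpow 3 a
  obtain ⟨B, hB⟩ := exists_isSymbol_cutoff 3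
  have hBA : 0 ≤ B * A := mul_nonneg (hB 1 le_rfl).const_nonneg hA.const_nonneg
  -- One factor `2 ^ 3` comes from the symbol bound for cutoff times weight, the other from
  -- Leibniz's rule applied to `f`. Neither depends on the cutoff radius.
  refine ⟨2 ^ 3 * (2 ^ 3 * (B * A)), by positivity, fun f K hfm hf => ?_⟩
  have key : ∀ n : ℕ, ∀ᵐ x, ‖cutoff (n + 1) x * weight x ^ a * f x‖ₑ ≤
      ENNReal.ofReal (2 ^ 3 * (2 ^ 3 * (B * A))) * K := by
    intro n
    have hη := (hB (n + 1) (by simp)).mul hA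
    rw [zero_add] at hη
    obtain ⟨g, hg, -, hgb⟩ := HasWeightedL1.symbol_mul (s := [0, 1, 2]) hη hf (by simp) hfm
    have hcs : HasCompactSupport (fun x => cutoff (n + 1) x * weight x ^ a * f x) :=
      (hasCompactSupport_cutoff (by positivity)).mul_right.mul_right
    filter_upwards [hg.ae_enorm_le hcs] with x hx
    refine hx.trans (hgb.trans (le_of_eq ?_))
    rw [ENNReal.ofReal_mul (by positivity) (q := 2 ^ 3 * (B * A)), mul_assoc]
    simp
  filter_upwards [ae_all_iff.2 key] with x hx
  obtain ⟨n, hn⟩ := exists_nat_ge ‖x‖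
  have h1 := hx n
  rw [cutoff_eq_one (by positivity) (by linarith), one_mul, enorm_mul,
    Real.enorm_eq_ofReal_abs (weight x ^ a), abs_of_nonneg
      (Real.rpow_nonneg (weight_pos x).le a)] at h1
  exact h1

/-! ### Square integrable functions -/

theorem lintegral_mul_sq_le {u v : E3 → ℝ≥0∞} (hu : AEMeasurable u volume)
    (hv : AEMeasurable v volume) :
    (∫⁻ x, u x * v x) ^ 2 ≤ (∫⁻ x, u x ^ 2) * ∫⁻ x, v x ^ 2 := by
  have h := ENNReal.lintegral_mul_le_Lp_mul_Lq volume Real.HolderConjugate.two_two hu hv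
  have h2 : ∀ r : ℝ≥0∞, (r ^ (1 / 2 : ℝ)) ^ 2 = r := fun r => by
    rw [← ENNReal.rpow_natCast, ← ENNReal.rpow_mul]; simp
  calc (∫⁻ x, u x * v x) ^ 2
      ≤ ((∫⁻ x, u x ^ (2 : ℝ)) ^ (1 / 2 : ℝ) * (∫⁻ x, v x ^ (2 : ℝ)) ^ (1 / 2 : ℝ)) ^ 2 := by
        gcongr; exact h
    _ = _ := by
        rw [mul_pow, h2, h2]; simp

theorem memLp_two_iff_lintegral {f : E3 → ℝ} (hf : AEStronglyMeasurable f volume) :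
    MemLp f 2 volume ↔ ∫⁻ x, ‖f x‖ₑ ^ 2 < ⊤ := by
  rw [MemLp, eLpNorm_lt_top_iff_lintegral_rpow_enorm_lt_top two_ne_zero ENNReal.ofNat_ne_top]
  simp [hf]

theorem lintegral_enorm_sq_eq {f : E3 → ℝ} (hf : MemLp f 2 volume) :
    ∫⁻ x, ‖f x‖ₑ ^ 2 = ENNReal.ofReal (∫ x, f x ^ 2) := by
  rw [ofReal_integral_eq_lintegral_ofReal hf.integrable_sq (ae_of_all _ fun x => sq_nonneg _)]
  refine lintegral_congr fun x => ?_
  rw [← enorm_pow, Real.enorm_of_nonneg (sq_nonneg _)]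

/-- Split the kernel as `√ρ · √ρ` and use Cauchy–Schwarz; the unit mass of `ρ` removes one factor,
and Tonelli with translation invariance the other. -/
theorem lintegral_enorm_mollify_sq_le (ρ : ContDiffBump (0 : E3)) {f : E3 → ℝ}
    (hf : AEStronglyMeasurable f volume) :
    ∫⁻ x, ‖mollify ρ f x‖ₑ ^ 2 ≤ ∫⁻ x, ‖f x‖ₑ ^ 2 := by
  have hρc : Continuous (ρ.normed (volume : Measure E3)) := ρ.continuous_normed
  have hρ1 : ∫⁻ x, ‖ρ.normed (volume : Measure E3) x‖ₑ = 1 := by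
    have h1 := ρ.integral_normed (μ := (volume : Measure E3))
    rw [← ofReal_integral_norm_eq_lintegral_enorm ρ.integrable_normed]
    simp_rw [Real.norm_of_nonneg (ρ.nonneg_normed _), h1, ENNReal.ofReal_one]
  have hhalf : ∀ z, ENNReal.ofReal (Real.sqrt (ρ.normed volume z)) ^ 2 =
      ‖ρ.normed (volume : Measure E3) z‖ₑ := fun z => by
    rw [← ENNReal.ofReal_pow (Real.sqrt_nonneg _), Real.sq_sqrt (ρ.nonneg_normed _),
      Real.enorm_of_nonneg (ρ.nonneg_normed _)]
  calc ∫⁻ x, ‖mollify ρ f x‖ₑ ^ 2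
      ≤ ∫⁻ x, ∫⁻ y, ‖f y‖ₑ ^ 2 * ‖ρ.normed volume (x - y)‖ₑ := by
        refine lintegral_mono fun x => ?_
        have hm : AEMeasurable (fun y => ENNReal.ofReal (Real.sqrt (ρ.normed volume (x - y))))
            volume :=
          (ENNReal.continuous_ofReal.comp (Real.continuous_sqrt.comp
            (hρc.comp (continuous_const.sub continuous_id)))).measurable.aemeasurable
        have hcs := lintegral_mul_sq_le (hf.enorm.mul hm) hm
        simp only [Pi.mul_apply, mul_pow, hhalf] at hcs
        rw [lintegral_sub_left_eq_self (fun z => ‖ρ.normed (volume : Measure E3) z‖ₑ) x, hρ1,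
          mul_one] at hcs
        refine le_trans ?_ hcs
        gcongr
        rw [mollify_apply]
        refine (enorm_integral_le_lintegral_enorm _).trans (le_of_eq ?_)
        refine lintegral_congr fun y => ?_
        rw [enorm_mul, mul_assoc, ← sq, hhalf]
    _ = ∫⁻ y, ∫⁻ x, ‖f y‖ₑ ^ 2 * ‖ρ.normed volume (x - y)‖ₑ := by
        refine lintegral_lintegral_swap ?_
        refine AEMeasurable.mul ((hf.enorm.pow_const 2).comp_quasiMeasurePreserving
          Measure.quasiMeasurePreserving_snd) ?_
        exact (hρc.comp (continuous_fst.sub continuous_snd)).enorm.measurable.aemeasurable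
    _ = ∫⁻ y, ‖f y‖ₑ ^ 2 := by
        refine lintegral_congr fun y => ?_
        rw [lintegral_const_mul' _ _ (ENNReal.pow_ne_top enorm_ne_top),
          lintegral_sub_right_eq_self (fun x => ‖ρ.normed volume x‖ₑ) y, hρ1, mul_one]

theorem integral_add_sq {F w : E3 → ℝ} (hF : MemLp F 2 volume) (hw : MemLp w 2 volume) :
    ∫ x, (F x + w x) ^ 2 = (∫ x, F x ^ 2) + 2 * (∫ x, F x * w x) + ∫ x, w x ^ 2 := by
  have h : Integrable (fun x => F x * w x) := hF.integrable_mul hw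
  have h' : Integrable (fun x => F x ^ 2 + 2 * (F x * w x)) :=
    hF.integrable_sq.add (h.const_mul 2)
  rw [← integral_const_mul, ← integral_add hF.integrable_sq (h.const_mul 2),
    ← integral_add h' hw.integrable_sq]
  congr 1; funext x; ring

/-- Almost everywhere convergence without increase of the norm implies weak convergence. -/
theorem tendsto_integral_mul_of_ae {Fn : ℕ → E3 → ℝ} {F w : E3 → ℝ}
    (hFn : ∀ n, MemLp (Fn n) 2 volume) (hF : MemLp F 2 volume) (hw : MemLp w 2 volume)
    (hlim : ∀ᵐ x, Tendsto (fun n => Fn n x) atTop (𝓝 (F x)))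
    (hle : ∀ n, ∫ x, Fn n x ^ 2 ≤ ∫ x, F x ^ 2) :
    Tendsto (fun n => ∫ x, Fn n x * w x) atTop (𝓝 (∫ x, F x * w x)) := by
  have key : ∀ w : E3 → ℝ, MemLp w 2 volume → ∀ ε > 0,
      ∀ᶠ n in atTop, (∫ x, F x * w x) - ε < ∫ x, Fn n x * w x := by
    intro w hw ε hε
    -- Fatou for `(Fn + w)²`: once the squares are expanded and `‖Fn‖ ≤ ‖F‖` is used, only a lower
    -- bound for the cross term is left. Replacing `w` by `-w` gives the upper bound.
    have hfat : ENNReal.ofReal (∫ x, (F x + w x) ^ 2) ≤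
        liminf (fun n => ENNReal.ofReal (∫ x, (Fn n x + w x) ^ 2)) atTop := by
      have h1 : ∀ n, ENNReal.ofReal (∫ x, (Fn n x + w x) ^ 2) = ∫⁻ x, ‖Fn n x + w x‖ₑ ^ 2 :=
        fun n => (lintegral_enorm_sq_eq ((hFn n).add hw)).symm
      have h2 : ENNReal.ofReal (∫ x, (F x + w x) ^ 2) = ∫⁻ x, ‖F x + w x‖ₑ ^ 2 :=
        (lintegral_enorm_sq_eq (hF.add hw)).symm
      simp_rw [h1, h2]
      refine le_trans (le_of_eq ?_) (lintegral_liminf_le'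
        fun n => (((hFn n).add hw).aestronglyMeasurable.enorm.pow_const 2))
      refine lintegral_congr_ae (hlim.mono fun x hx => ?_)
      exact (((ENNReal.continuous_pow 2).tendsto _).comp
        (hx.add_const (w x)).enorm).liminf_eq.symm
    have hev : ∀ᶠ n in atTop, (∫ x, (F x + w x) ^ 2) - ε < ∫ x, (Fn n x + w x) ^ 2 := by
      -- The negative case is trivial but must be separated, since `ENNReal.ofReal` truncates it.
      by_cases h0 : (∫ x, (F x + w x) ^ 2) - ε < 0
      · exact Eventually.of_forall fun n => h0.trans_le (integral_nonneg fun x => sq_nonneg _)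
      · have hlt : ENNReal.ofReal ((∫ x, (F x + w x) ^ 2) - ε) <
            liminf (fun n => ENNReal.ofReal (∫ x, (Fn n x + w x) ^ 2)) atTop :=
          lt_of_lt_of_le ((ENNReal.ofReal_lt_ofReal_iff (by linarith)).2 (by linarith)) hfat
        filter_upwards [eventually_lt_of_lt_liminf hlt] with n hn
        exact (ENNReal.ofReal_lt_ofReal_iff_of_nonneg (by linarith)).1 hn
    filter_upwards [hev] with n hn
    rw [integral_add_sq hF hw, integral_add_sq (hFn n) hw] at hn
    linarith [hle n]
  rw [tendsto_order]
  refine ⟨fun a ha => ?_, fun a ha => ?_⟩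
  · filter_upwards [key w hw _ (sub_pos.2 ha)] with n hn
    linarith
  · filter_upwards [key (-w) hw.neg _ (sub_pos.2 ha)] with n hn
    simp only [Pi.neg_apply, mul_neg, integral_neg] at hn
    linarith

theorem memLp_mollify (ρ : ContDiffBump (0 : E3)) {f : E3 → ℝ} (hf : MemLp f 2 volume)
    (hl : LocallyIntegrable f volume) : MemLp (mollify ρ f) 2 volume := by
  rw [memLp_two_iff_lintegral (contDiff_mollify ρ hl).continuous.aestronglyMeasurable]
  exact (lintegral_enorm_mollify_sq_le ρ hf.1).trans_lt ((memLp_two_iff_lintegral hf.1).1 hf)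

theorem tendsto_integral_mollify_mul {f w : E3 → ℝ} (hf : MemLp f 2 volume)
    (hw : MemLp w 2 volume) :
    Tendsto (fun n => ∫ x, mollify (bumpSeq n) f x * w x) atTop (𝓝 (∫ x, f x * w x)) := by
  have hl : LocallyIntegrable f volume := hf.locallyIntegrable (by norm_num)
  refine tendsto_integral_mul_of_ae (fun n => memLp_mollify _ hf hl) hf hw
    (tendsto_mollify_bumpSeq hl) fun n => ?_
  have h := lintegral_enorm_mollify_sq_le (bumpSeq n) hf.1
  rw [lintegral_enorm_sq_eq (memLp_mollify _ hf hl), lintegral_enorm_sq_eq hf] at h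
  exact (ENNReal.ofReal_le_ofReal_iff (integral_nonneg fun x => sq_nonneg _)).1 h

/-! ### Integration by parts -/

theorem memLp_symbol_mul {n : ℕ} {a C : ℝ} {η f : E3 → ℝ} (hη : IsSymbol n a C η) (ha : a ≤ 0)
    (hf : MemLp f 2 volume) : MemLp (fun x => η x * f x) 2 volume := by
  refine hf.of_le_mul (c := C) (hη.contDiff.continuous.aestronglyMeasurable.mul hf.1)
    (ae_of_all _ fun x => ?_)
  rw [norm_mul]
  refine mul_le_mul_of_nonneg_right ((hη.abs_le x).trans ?_) (norm_nonneg _)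
  exact mul_le_of_le_one_right hη.const_nonneg (Real.rpow_le_one_of_one_le_of_nonpos
    (one_le_weight x) ha)

namespace HasWeakPartial

variable {i : Fin 3} {f f' g g' : E3 → ℝ}

/-- Mollifying `f` alone yields test functions for `g`; weak `L²` convergence then passes to the
limit on both sides. -/
theorem integral_mul_eq_of_hasCompactSupport (hf : HasWeakPartial i f f')
    (hg : HasWeakPartial i g g') (hf2 : MemLp f 2 volume) (hf2' : MemLp f' 2 volume)
    (hg2 : MemLp g 2 volume) (hg2' : MemLp g' 2 volume) (hc : HasCompactSupport f) :
    ∫ x, f x * g' x = -∫ x, f' x * g x := by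
  have h1 := tendsto_integral_mollify_mul hf2 hg2'
  have h2 := (tendsto_integral_mollify_mul hf2' hg2).neg
  refine tendsto_nhds_unique h1 (h2.congr fun n => ?_)
  have h3 := hg.integral_mul_pd (contDiff_mollify (bumpSeq n) hf.1)
    (hasCompactSupport_mollify (bumpSeq n) hc)
  rw [pd_mollify _ hf] at h3
  simp only [mul_comm (g _), mul_comm (g' _)] at h3
  rw [h3, neg_neg]

/-- Multiply `f` by cutoffs of growing radius. Their derivatives are uniformly bounded and
eventually vanish at each point, so dominated convergence leaves no boundary term. -/
theorem integral_mul_eq (hf : HasWeakPartial i f f')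
    (hg : HasWeakPartial i g g') (hf2 : MemLp f 2 volume) (hf2' : MemLp f' 2 volume)
    (hg2 : MemLp g 2 volume) (hg2' : MemLp g' 2 volume) :
    ∫ x, f x * g' x = -∫ x, f' x * g x := by
  obtain ⟨C, hC⟩ := exists_isSymbol_cutoff 1
  have hR : ∀ n : ℕ, (1 : ℝ) ≤ n + 1 := fun n => by simp
  have hC0 : 0 ≤ C := (hC 1 le_rfl).const_nonneg
  have hχ : ∀ (n : ℕ) x, |cutoff (n + 1) x| ≤ C := fun n x => by
    simpa using (hC _ (hR n)).abs_le x
  have hχ' : ∀ (n : ℕ) x, |pd i (cutoff (n + 1)) x| ≤ C := fun n x =>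
    (((hC _ (hR n)).2 i).abs_le x).trans (mul_le_of_le_one_right hC0
      (Real.rpow_le_one_of_one_le_of_nonpos (one_le_weight x) (by norm_num)))
  have hev : ∀ x : E3, ∀ᶠ n : ℕ in atTop, cutoff (n + 1) x = 1 ∧ pd i (cutoff (n + 1)) x = 0 := by
    intro x
    obtain ⟨N, hN⟩ := exists_nat_gt ‖x‖
    filter_upwards [eventually_ge_atTop N] with n hn
    have hn' : (N : ℝ) ≤ n := by exact_mod_cast hn
    refine ⟨cutoff_eq_one (by positivity) (by linarith), ?_⟩
    have : cutoff (n + 1) =ᶠ[𝓝 x] fun _ => 1 := by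
      filter_upwards [(isOpen_ball (x := (0 : E3)) (ε := (n : ℝ) + 1)).mem_nhds
        (by rw [mem_ball_zero_iff]; linarith)] with y hy
      rw [mem_ball_zero_iff] at hy
      exact cutoff_eq_one (by positivity) hy.le
    rw [pd, this.fderiv_eq]; simp
  have key : ∀ n : ℕ, ∫ x, cutoff (n + 1) x * f x * g' x =
      -∫ x, (cutoff (n + 1) x * f' x + pd i (cutoff (n + 1)) x * f x) * g x := fun n =>
    (hf.smooth_mul (contDiff_cutoff (n + 1))).integral_mul_eq_of_hasCompactSupport hg
      (memLp_symbol_mul (hC _ (hR n)) le_rfl hf2)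
      ((memLp_symbol_mul (hC _ (hR n)) le_rfl hf2').add
        (memLp_symbol_mul ((hC _ (hR n)).2 i) (by norm_num) hf2)) hg2 hg2'
      (hasCompactSupport_cutoff (by positivity)).mul_right
  have hm : ∀ n : ℕ, AEStronglyMeasurable (cutoff ((n : ℝ) + 1)) volume := fun n =>
    (contDiff_cutoff _).continuous.aestronglyMeasurable
  have hm' : ∀ n : ℕ, AEStronglyMeasurable (pd i (cutoff ((n : ℝ) + 1))) volume := fun n =>
    (contDiff_pd (contDiff_cutoff _) i).continuous.aestronglyMeasurable
  have i1 : Integrable (fun x => f x * g' x) := hf2.integrable_mul hg2'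
  have i2 : Integrable (fun x => f' x * g x) := hf2'.integrable_mul hg2
  have i3 : Integrable (fun x => f x * g x) := hf2.integrable_mul hg2
  have l1 : Tendsto (fun n : ℕ => ∫ x, cutoff (n + 1) x * f x * g' x) atTop
      (𝓝 (∫ x, f x * g' x)) := by
    refine tendsto_integral_of_dominated_convergence (fun x => C * ‖f x * g' x‖)
      (fun n => ((hm n).mul hf2.1).mul hg2'.1) (i1.norm.const_mul C)
      (fun n => ae_of_all _ fun x => ?_) (ae_of_all _ fun x => ?_)
    · rw [mul_assoc, norm_mul]
      exact mul_le_mul_of_nonneg_right (hχ n x) (norm_nonneg _)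
    · refine tendsto_const_nhds.congr' ((hev x).mono fun n hn => ?_)
      simp only [hn.1, one_mul]
  have l2 : Tendsto (fun n : ℕ => ∫ x, (cutoff (n + 1) x * f' x +
      pd i (cutoff (n + 1)) x * f x) * g x) atTop (𝓝 (∫ x, f' x * g x)) := by
    refine tendsto_integral_of_dominated_convergence
      (fun x => C * ‖f' x * g x‖ + C * ‖f x * g x‖)
      (fun n => (((hm n).mul hf2'.1).add ((hm' n).mul hf2.1)).mul hg2.1)
      ((i2.norm.const_mul C).add (i3.norm.const_mul C))
      (fun n => ae_of_all _ fun x => ?_) (ae_of_all _ fun x => ?_)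
    · rw [add_mul, mul_assoc, mul_assoc]
      refine (norm_add_le _ _).trans (add_le_add ?_ ?_) <;> rw [norm_mul]
      · exact mul_le_mul_of_nonneg_right (hχ n x) (norm_nonneg _)
      · exact mul_le_mul_of_nonneg_right (hχ' n x) (norm_nonneg _)
    · refine tendsto_const_nhds.congr' ((hev x).mono fun n hn => ?_)
      simp only [hn.1, hn.2, one_mul, zero_mul, add_zero]
  exact tendsto_nhds_unique l1 (l2.neg.congr fun n => (key n).symm)

/-- The integral of a Jacobian of two functions in `H²` vanishes. -/
theorem integral_jacobian_eq {i j : Fin 3} {u v ui uj vi vj uij uji : E3 → ℝ}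
    (hui : HasWeakPartial i u ui) (huj : HasWeakPartial j u uj) (hvi : HasWeakPartial i v vi)
    (hvj : HasWeakPartial j v vj) (huij : HasWeakPartial j ui uij) (huji : HasWeakPartial i uj uji)
    (mv : MemLp v 2 volume) (mui : MemLp ui 2 volume)
    (muj : MemLp uj 2 volume) (mvi : MemLp vi 2 volume) (mvj : MemLp vj 2 volume)
    (muij : MemLp uij 2 volume) (muji : MemLp uji 2 volume) :
    ∫ x, ui x * vj x = ∫ x, uj x * vi x := by
  -- Both sides become minus the integral of a mixed second derivative of `u` against `v`.
  rw [huij.integral_mul_eq hvj mui muij mv mvj, huji.integral_mul_eq hvi muj muji mv mvi]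
  congr 1
  refine integral_congr_ae ?_
  filter_upwards [hui.comm huij huj huji] with x hx
  rw [hx]

end HasWeakPartial

/-! ### The Hardy inequality -/

theorem weight_rpow_neg_two (x : E3) : weight x ^ (-2 : ℝ) = (weight x ^ 2)⁻¹ := by
  rw [Real.rpow_neg (weight_pos x).le]; norm_cast

theorem pd_hardy (i : Fin 3) (x : E3) :
    pd i (fun x : E3 => x i * weight x ^ (-2 : ℝ)) x =
      weight x ^ (-2 : ℝ) - 2 * x i ^ 2 * (weight x ^ (-2 : ℝ)) ^ 2 := by
  rw [pd_mul (IsSymbol.coord 0 i).contDiff (contDiff_weight_rpow _), pd_weight_rpow]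
  have : HasFDerivAt (fun x : E3 => x i) (EuclideanSpace.proj i : E3 →L[ℝ] ℝ) x :=
    (EuclideanSpace.proj i : E3 →L[ℝ] ℝ).hasFDerivAt
  have h1 : pd i (fun x : E3 => x i) x = 1 := by simp [pd, this.fderiv]
  have h2 : weight x ^ ((-2 : ℝ) - 2) = (weight x ^ (-2 : ℝ)) ^ 2 := by
    rw [← Real.rpow_natCast, ← Real.rpow_mul (weight_pos x).le]; norm_num
  simp only [h1, h2]; ring

/-- With `t = f(x)` and `d = ∇f(x)` the right side is the divergence of `f² X`, `X = x σ⁻²`. Here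
`div X = σ⁻² + 2σ⁻⁴ ≥ σ⁻²`, and the cross term `2 f X·∇f` is absorbed by completing the square and
Cauchy–Schwarz. -/
theorem hardy_pointwise (x : E3) (t : ℝ) (d : Fin 3 → ℝ) :
    t ^ 2 * weight x ^ (-2 : ℝ) / 2 - 2 * ∑ i, d i ^ 2 ≤
      ∑ i, (t * (x i * weight x ^ (-2 : ℝ) * d i +
        (weight x ^ (-2 : ℝ) - 2 * x i ^ 2 * (weight x ^ (-2 : ℝ)) ^ 2) * t) +
          d i * (x i * weight x ^ (-2 : ℝ) * t)) := by
  have hx : ‖x‖ ^ 2 = x 0 ^ 2 + x 1 ^ 2 + x 2 ^ 2 := by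
    rw [EuclideanSpace.norm_sq_eq, Fin.sum_univ_three]; simp
  have hw := weight_sq x
  have hwp := weight_pos x
  rw [weight_rpow_neg_two]
  set W := (weight x ^ 2)⁻¹ with hW
  have hW0 : 0 < W := by positivity
  have h1 : W * (1 + (x 0 ^ 2 + x 1 ^ 2 + x 2 ^ 2)) = 1 := by
    rw [← hx, ← hw, hW]; exact inv_mul_cancel₀ (by positivity)
  simp only [Fin.sum_univ_three]
  set S := x 0 * d 0 + x 1 * d 1 + x 2 * d 2 with hS
  set N := d 0 ^ 2 + d 1 ^ 2 + d 2 ^ 2 with hN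
  have hcs : S ^ 2 ≤ (x 0 ^ 2 + x 1 ^ 2 + x 2 ^ 2) * N := by
    nlinarith [sq_nonneg (x 0 * d 1 - x 1 * d 0), sq_nonneg (x 0 * d 2 - x 2 * d 0),
      sq_nonneg (x 1 * d 2 - x 2 * d 1)]
  have hN0 : 0 ≤ N := by positivity
  have h2 : W * S ^ 2 ≤ N := by
    calc W * S ^ 2 ≤ W * ((x 0 ^ 2 + x 1 ^ 2 + x 2 ^ 2) * N) := by gcongr
      _ = (1 - W) * N := by linear_combination N * h1
      _ ≤ N := by nlinarith
  have h3 : 0 ≤ W * (t + 2 * S) ^ 2 := by positivity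
  have h4 : 0 ≤ W ^ 2 * t ^ 2 := by positivity
  have h5 : (x 0 ^ 2 + x 1 ^ 2 + x 2 ^ 2) * W ^ 2 = W - W ^ 2 := by linear_combination W * h1
  have h6 : ∀ A : ℝ, A = 2 * t * W * S + t ^ 2 * (W + 2 * W ^ 2) →
      t ^ 2 * W / 2 - 2 * N ≤ A := by
    intro A hA; rw [hA]; nlinarith
  apply h6
  rw [hS]
  linear_combination (-2 * t ^ 2) * h5

/-- The Hardy inequality `‖σ⁻¹ f‖ ≤ 2 ‖∇f‖`. -/
theorem integral_hardy_le {f : E3 → ℝ} {f' : Fin 3 → E3 → ℝ}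
    (h : ∀ i, HasWeakPartial i f (f' i)) (hf : MemLp f 2 volume)
    (hf' : ∀ i, MemLp (f' i) 2 volume) :
    ∫ x, f x ^ 2 * weight x ^ (-2 : ℝ) ≤ 4 * ∑ i, ∫ x, f' i x ^ 2 := by
  set X : Fin 3 → E3 → ℝ := fun i x => x i * weight x ^ (-2 : ℝ) with hX
  obtain ⟨C, hC⟩ := IsSymbol.weight_rpow 1 (-2)
  have hXs : ∀ i, IsSymbol 1 (1 + -2) _ (X i) := fun i => (IsSymbol.coord 1 i).mul hC
  have hsm := fun i => (h i).smooth_mul (hXs i).contDiff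
  have m1 : ∀ i, MemLp (fun x => X i x * f x) 2 volume := fun i =>
    memLp_symbol_mul (hXs i) (by norm_num) hf
  have m2 : ∀ i, MemLp (fun x => X i x * f' i x + pd i (X i) x * f x) 2 volume := fun i =>
    (memLp_symbol_mul (hXs i) (by norm_num) (hf' i)).add
      (memLp_symbol_mul ((hXs i).2 i) (by norm_num) hf)
  have hz : ∀ i, ∫ x, (f x * (X i x * f' i x + pd i (X i) x * f x) + f' i x * (X i x * f x)) = 0 := by
    intro i
    have h1 : Integrable (fun x => f x * (X i x * f' i x + pd i (X i) x * f x)) :=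
      hf.integrable_mul (m2 i)
    have h2 : Integrable (fun x => f' i x * (X i x * f x)) := (hf' i).integrable_mul (m1 i)
    rw [integral_add h1 h2, (h i).integral_mul_eq (hsm i) hf (hf' i) (m1 i) (m2 i)]
    ring
  have hint : ∀ i, Integrable (fun x => f x * (X i x * f' i x + pd i (X i) x * f x) +
      f' i x * (X i x * f x)) := fun i =>
    (hf.integrable_mul (m2 i)).add ((hf' i).integrable_mul (m1 i))
  have hWint : Integrable (fun x => f x ^ 2 * weight x ^ (-2 : ℝ)) := by
    have hm := hf.integrable_mul (memLp_symbol_mul hC (by norm_num) hf)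
    refine hm.congr (ae_of_all _ fun x => ?_)
    simp only [Pi.mul_apply]; ring
  have hle : ∫ x, (f x ^ 2 * weight x ^ (-2 : ℝ) / 2 - 2 * ∑ i, f' i x ^ 2) ≤
      ∫ x, ∑ i, (f x * (X i x * f' i x + pd i (X i) x * f x) + f' i x * (X i x * f x)) := by
    refine integral_mono ((hWint.div_const 2).sub
      ((integrable_finsetSum _ fun i _ => (hf' i).integrable_sq).const_mul 2))
      (integrable_finsetSum _ fun i _ => hint i) fun x => ?_
    simp only [hX, pd_hardy]
    exact hardy_pointwise x (f x) fun i => f' i x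
  rw [integral_finsetSum _ fun i _ => hint i, Finset.sum_eq_zero fun i _ => hz i,
    integral_sub (hWint.div_const 2)
      ((integrable_finsetSum _ fun i _ => (hf' i).integrable_sq).const_mul 2),
    integral_div, integral_const_mul, integral_finsetSum _ fun i _ => (hf' i).integrable_sq] at hle
  linarith

/-! ### Coercivity of the flat operator -/

theorem HasWeakPartial.const (i : Fin 3) (c : ℝ) : HasWeakPartial i (fun _ => c) (fun _ => 0) := by
  refine ⟨locallyIntegrable_const c, locallyIntegrable_const 0, fun φ hφ hc => ?_⟩
  have hd := contDiff_pd hφ i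
  have h := integral_mul_fderiv_eq_neg_fderiv_mul_of_integrable (𝕜 := ℝ) (μ := (volume : Measure E3))
    (f := fun _ => c) (g := φ) (v := EuclideanSpace.single i (1 : ℝ)) (by simp)
    ((hd.continuous.integrable_of_hasCompactSupport (hasCompactSupport_pd hc i)).const_mul c)
    ((hφ.continuous.integrable_of_hasCompactSupport hc).const_mul c)
    (fun _ _ => differentiableAt_const _) (fun x _ => hφ.differentiable (by simp) x)
  rw [h]; simp

theorem memLp_flatD {D : Fin 3 → Fin 3 → Fin 3 → Fin 3 → E3 → ℝ}
    (hD : ∀ k a b c, MemLp (D k a b c) 2 volume) (a c : Fin 3) :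
    MemLp (fun x => flatD (fun k a b c => D k a b c x) a c) 2 volume :=
  ((memLp_finsetSum _ fun b _ => hD b a b c).add (memLp_finsetSum _ fun b _ => hD b c b a)).sub
    (((memLp_finsetSum _ fun b _ => memLp_finsetSum _ fun u _ => hD b u b u).const_mul
      (2 / 3)).mul_const _)

theorem memLp_flatQ {D : Fin 3 → Fin 3 → Fin 3 → Fin 3 → E3 → ℝ}
    (hD : ∀ k a b c, MemLp (D k a b c) 2 volume) (a : Fin 3) :
    MemLp (fun x => flatQ (fun k a b c => D k a b c x) a) 2 volume :=
  memLp_finsetSum _ fun e _ => memLp_finsetSum _ fun b _ => memLp_finsetSum _ fun c _ =>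
    (hD e a b c).const_mul _

theorem integrable_sqNorm {D : Fin 3 → Fin 3 → Fin 3 → Fin 3 → E3 → ℝ}
    (hD : ∀ k a b c, MemLp (D k a b c) 2 volume) :
    Integrable (fun x => sqNorm (fun k a b c => D k a b c x)) :=
  integrable_finsetSum _ fun k _ => integrable_finsetSum _ fun a _ =>
    integrable_finsetSum _ fun b _ => integrable_finsetSum _ fun c _ => (hD k a b c).integrable_sq

theorem integrable_flat_sq {D : Fin 3 → Fin 3 → Fin 3 → Fin 3 → E3 → ℝ}
    (hD : ∀ k a b c, MemLp (D k a b c) 2 volume) :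
    Integrable (fun x => (∑ a, ∑ c, flatD (fun k a b c => D k a b c x) a c ^ 2) +
      ∑ a, flatQ (fun k a b c => D k a b c x) a ^ 2) :=
  (integrable_finsetSum _ fun a _ => integrable_finsetSum _ fun c _ =>
    (memLp_flatD hD a c).integrable_sq).add
    (integrable_finsetSum _ fun a _ => (memLp_flatQ hD a).integrable_sq)

/-- The flat operator controls the full gradient of a Jacobi tensor in `L²`. -/
theorem integral_sqNorm_le {u : Fin 3 → Fin 3 → Fin 3 → E3 → ℝ}
    {D : Fin 3 → Fin 3 → Fin 3 → Fin 3 → E3 → ℝ}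
    (hu : ∀ k a b c, HasWeakPartial k (u a b c) (D k a b c))
    (mu : ∀ a b c, MemLp (u a b c) 2 volume) (mD : ∀ k a b c, MemLp (D k a b c) 2 volume)
    (hD : ∀ l k a b c, ∃ H, HasWeakPartial l (D k a b c) H ∧ MemLp H 2 volume)
    (hcyc : ∀ a b c, ∀ᵐ x, u a b c x + u c a b x + u b c a x = 0)
    (hanti : ∀ a b c, ∀ᵐ x, u a b c x + u a c b x = 0) :
    ∫ x, sqNorm (fun k a b c => D k a b c x) ≤
      4 * ∫ x, ((∑ a, ∑ c, flatD (fun k a b c => D k a b c x) a c ^ 2) +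
        ∑ a, flatQ (fun k a b c => D k a b c x) a ^ 2) := by
  have hjac : ∀ i k a b c a' b' c',
      Integrable (fun x => D i a b c x * D k a' b' c' x - D k a b c x * D i a' b' c' x) ∧
      ∫ x, (D i a b c x * D k a' b' c' x - D k a b c x * D i a' b' c' x) = 0 := by
    intro i k a b c a' b' c'
    have i1 : Integrable (fun x => D i a b c x * D k a' b' c' x) :=
      (mD i a b c).integrable_mul (mD k a' b' c')
    have i2 : Integrable (fun x => D k a b c x * D i a' b' c' x) :=
      (mD k a b c).integrable_mul (mD i a' b' c')
    obtain ⟨H, hH, mH⟩ := hD k i a b c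
    obtain ⟨H', hH', mH'⟩ := hD i k a b c
    refine ⟨i1.sub i2, ?_⟩
    rw [integral_sub i1 i2, sub_eq_zero]
    exact HasWeakPartial.integral_jacobian_eq (hu i a b c) (hu k a b c) (hu i a' b' c')
      (hu k a' b' c') hH hH' (mu _ _ _) (mD _ _ _ _) (mD _ _ _ _) (mD _ _ _ _) (mD _ _ _ _) mH mH'
  have hnull : Integrable (fun x => nullForm (fun k a b c => D k a b c x)) ∧
      ∫ x, nullForm (fun k a b c => D k a b c x) = 0 := by
    have hlin : ∀ p q r : E3 → ℝ, (Integrable p ∧ ∫ x, p x = 0) → (Integrable q ∧ ∫ x, q x = 0) →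
        (Integrable r ∧ ∫ x, r x = 0) → Integrable (fun x => 2 * p x - 2 * q x - 3 * r x) ∧
          ∫ x, (2 * p x - 2 * q x - 3 * r x) = 0 := by
      rintro p q r ⟨hp, zp⟩ ⟨hq, zq⟩ ⟨hr, zr⟩
      have hpq : Integrable (fun x => 2 * p x - 2 * q x) := (hp.const_mul 2).sub (hq.const_mul 2)
      refine ⟨hpq.sub (hr.const_mul 3), ?_⟩
      rw [integral_sub hpq (hr.const_mul 3), integral_sub (hp.const_mul 2) (hq.const_mul 2),
        integral_const_mul, integral_const_mul, integral_const_mul, zp, zq, zr]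
      simp
    -- The shifts by `1` and `2` unfold `jacM`; each bracket of `nullForm` is one Jacobian in the
    -- directions `i` and `k`.
    have h1 := fun i j k : Fin 3 => hlin _ _ _ (hjac i k i (j + 1) (j + 2) k (j + 1) (j + 2))
      (hjac i k j (i + 1) (i + 2) j (k + 1) (k + 2)) (hjac i k i (j + 1) (j + 2) j (k + 1) (k + 2))
    refine ⟨integrable_finsetSum _ fun i _ => integrable_finsetSum _ fun j _ =>
      integrable_finsetSum _ fun k _ => (h1 i j k).1, ?_⟩
    simp only [nullForm, jacM]
    rw [integral_finsetSum _ fun i _ => integrable_finsetSum _ fun j _ =>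
      integrable_finsetSum _ fun k _ => (h1 i j k).1]
    refine Finset.sum_eq_zero fun i _ => ?_
    rw [integral_finsetSum _ fun j _ => integrable_finsetSum _ fun k _ => (h1 i j k).1]
    refine Finset.sum_eq_zero fun j _ => ?_
    rw [integral_finsetSum _ fun k _ => (h1 i j k).1]
    exact Finset.sum_eq_zero fun k _ => (h1 i j k).2
  -- The algebraic symmetries pass to the derivatives by uniqueness of the weak derivative of the
  -- zero function.
  have hc : ∀ k a b c, ∀ᵐ x, D k a b c x + D k c a b x + D k b c a x = 0 := fun k a b c =>
    (((hu k a b c).add (hu k c a b)).add (hu k b c a)).unique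
      ((HasWeakPartial.const k 0).congr ((hcyc a b c).mono fun x hx => hx.symm) (ae_eq_refl _))
  have ha : ∀ k a b c, ∀ᵐ x, D k a b c x + D k a c b x = 0 := fun k a b c =>
    ((hu k a b c).add (hu k a c b)).unique
      ((HasWeakPartial.const k 0).congr ((hanti a b c).mono fun x hx => hx.symm) (ae_eq_refl _))
  have hpt : ∀ᵐ x, sqNorm (fun k a b c => D k a b c x) ≤
      4 * (((∑ a, ∑ c, flatD (fun k a b c => D k a b c x) a c ^ 2) +
        ∑ a, flatQ (fun k a b c => D k a b c x) a ^ 2) + nullForm (fun k a b c => D k a b c x)) := by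
    simp only [← ae_all_iff] at hc ha
    filter_upwards [hc, ha] with x hx1 hx2
    exact sqNorm_le_flat _ hx1 hx2
  have hle := integral_mono_ae (integrable_sqNorm mD)
    (((integrable_flat_sq mD).add hnull.1).const_mul 4) hpt
  refine hle.trans (le_of_eq ?_)
  rw [integral_const_mul]
  simp only [Pi.add_apply]
  rw [integral_add (integrable_flat_sq mD) hnull.1, hnull.2, add_zero]

/-! ### Consequences of finite weighted Sobolev norms -/

theorem lintegral_wderiv_le {k r : ℕ} (β : ℝ) (T : TensorField r) (I : Fin r → Fin 3)
    {s : List (Fin 3)} (hs : s.length ≤ k) :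
    ∫⁻ x, ENNReal.ofReal ((wderiv s (T I) x) ^ 2 *
      weight x ^ (-2 * (β - (s.length : ℝ)) - 3)) ≤ sobolevNorm k β T ^ 2 := by
  have hsq : ∀ r : ℝ≥0∞, (r ^ (1 / 2 : ℝ)) ^ 2 = r := fun r => by
    rw [← ENNReal.rpow_natCast, ← ENNReal.rpow_mul]; simp
  rw [sobolevNorm, hsq]
  set F : (l : ℕ) → (Fin r → Fin 3) → (Fin l → Fin 3) → ℝ≥0∞ := fun l I s =>
    ∫⁻ x, ENNReal.ofReal ((wderiv (List.ofFn s) (T I) x) ^ 2 *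
      weight x ^ (-2 * (β - (l : ℝ)) - 3)) with hF
  calc _ = F s.length I s.get := by simp only [hF, List.ofFn_get]
    _ ≤ ∑ t : Fin s.length → Fin 3, F s.length I t :=
        Finset.single_le_sum (f := fun t => F s.length I t) (fun _ _ => zero_le)
          (Finset.mem_univ _)
    _ ≤ ∑ I, ∑ t : Fin s.length → Fin 3, F s.length I t :=
        Finset.single_le_sum (f := fun I => ∑ t, F s.length I t) (fun _ _ => zero_le)
          (Finset.mem_univ _)
    _ ≤ ∑ l ∈ Finset.range (k + 1), ∑ I, ∑ t, F l I t :=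
        Finset.single_le_sum (f := fun l => ∑ I, ∑ t, F l I t) (fun _ _ => zero_le)
          (Finset.mem_range.2 (by omega))

theorem MemSobolev.memLp_wderiv {k r : ℕ} {β : ℝ} {T : TensorField r} (hT : MemSobolev k β T)
    (I : Fin r → Fin 3) {s : List (Fin 3)} (hs : s.length ≤ k)
    (hβ : 0 ≤ -2 * (β - (s.length : ℝ)) - 3) : MemLp (wderiv s (T I)) 2 volume := by
  rw [memLp_two_iff_lintegral ((hT.1 I).1 s hs).aestronglyMeasurable]
  refine lt_of_le_of_lt (lintegral_mono fun x => ?_) ((lintegral_wderiv_le β T I hs).trans_lt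
    (ENNReal.pow_lt_top hT.2))
  rw [← enorm_pow, Real.enorm_of_nonneg (sq_nonneg _)]
  exact ENNReal.ofReal_le_ofReal (le_mul_of_one_le_right (sq_nonneg _)
    (Real.one_le_rpow (one_le_weight x) hβ))

theorem lintegral_weight_rpow_lt_top {p : ℝ} (hp : p < -3) :
    ∫⁻ x, ENNReal.ofReal (weight x ^ p) < ⊤ := by
  have h := integrable_rpow_neg_one_add_norm_sq (E := E3) (μ := volume) (r := -p)
    (by simp; linarith)
  simp only [neg_neg, ← weight_rpow_eq] at h
  have h2 := h.2
  rw [hasFiniteIntegral_iff_ofReal (ae_of_all _ fun x => Real.rpow_nonneg (weight_pos x).le p)] at h2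
  exact h2

/-- Cauchy–Schwarz after splitting `σ^{l-3} = σ^{-(β-l)-3/2} · σ^{β-3/2}`. The last factor is square
integrable when `β < 0`; the `L¹` weights no longer involve `β`. -/
theorem MemSobolev.hasWeightedL1 {k r : ℕ} {β : ℝ} {T : TensorField r} (hT : MemSobolev k β T)
    (I : Fin r → Fin 3) {n : ℕ} {s : List (Fin 3)} (hs : n + s.length ≤ k) :
    HasWeightedL1 n ((s.length : ℝ) - 3)
      (sobolevNorm k β T * (∫⁻ x, ENNReal.ofReal (weight x ^ (2 * β - 3))) ^ (1 / 2 : ℝ))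
      (wderiv s (T I)) := by
  have hsq : ∀ r : ℝ≥0∞, (r ^ (1 / 2 : ℝ)) ^ 2 = r := fun r => by
    rw [← ENNReal.rpow_natCast, ← ENNReal.rpow_mul]; simp
  have base : ∀ s : List (Fin 3), s.length ≤ k →
      ∫⁻ x, ‖wderiv s (T I) x‖ₑ * ENNReal.ofReal (weight x ^ ((s.length : ℝ) - 3)) ≤
        sobolevNorm k β T * (∫⁻ x, ENNReal.ofReal (weight x ^ (2 * β - 3))) ^ (1 / 2 : ℝ) := by
    intro s hs
    rw [← ENNReal.pow_le_pow_left_iff two_ne_zero, mul_pow, hsq]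
    have hm := ((hT.1 I).1 s hs).aestronglyMeasurable
    have hw : ∀ p : ℝ, AEMeasurable (fun x => ENNReal.ofReal (weight x ^ p)) volume := fun p =>
      (contDiff_weight_rpow p).continuous.measurable.ennreal_ofReal.aemeasurable
    have hcs := lintegral_mul_sq_le (hm.enorm.mul (hw (-(β - s.length) - 3 / 2))) (hw (β - 3 / 2))
    simp only [Pi.mul_apply, mul_pow] at hcs
    have hpow : ∀ (p : ℝ) (x : E3), ENNReal.ofReal (weight x ^ p) ^ 2 =
        ENNReal.ofReal (weight x ^ (2 * p)) := fun p x => by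
      rw [← ENNReal.ofReal_pow (Real.rpow_nonneg (weight_pos x).le p), ← Real.rpow_natCast,
        ← Real.rpow_mul (weight_pos x).le, mul_comm p]
      norm_cast
    calc (∫⁻ x, ‖wderiv s (T I) x‖ₑ * ENNReal.ofReal (weight x ^ ((s.length : ℝ) - 3))) ^ 2
        = (∫⁻ x, ‖wderiv s (T I) x‖ₑ * ENNReal.ofReal (weight x ^ (-(β - s.length) - 3 / 2)) *
            ENNReal.ofReal (weight x ^ (β - 3 / 2))) ^ 2 := by
          congr 1
          refine lintegral_congr fun x => ?_
          rw [mul_assoc, ← ENNReal.ofReal_mul (Real.rpow_nonneg (weight_pos x).le _),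
            ← Real.rpow_add (weight_pos x)]
          ring_nf
      _ ≤ _ := hcs
      _ ≤ _ := by
          gcongr ?_ * ?_
          · refine le_trans (le_of_eq (lintegral_congr fun x => ?_)) (lintegral_wderiv_le β T I hs)
            rw [hpow, ← enorm_pow, Real.enorm_of_nonneg (sq_nonneg _),
              ← ENNReal.ofReal_mul (sq_nonneg _)]
            ring_nf
          · refine le_of_eq (lintegral_congr fun x => ?_)
            rw [hpow]
            ring_nf
  induction n generalizing s with
  | zero => exact base s (by omega)
  | succ n ih =>
    refine ⟨base s (by omega), fun i => ⟨_, (hT.1 I).2 s (by omega) i, ?_⟩⟩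
    have := ih (s := i :: s) (by simp only [List.length_cons]; omega)
    simp only [List.length_cons, Nat.cast_add, Nat.cast_one] at this
    rwa [show (s.length : ℝ) + 1 - 3 = s.length - 3 + 1 by ring] at this

/-- The weighted Sobolev embedding for a tensor field and its first derivatives. -/
theorem exists_ae_bound {β : ℝ} (hβ : β < 0) : ∃ C : ℝ, 0 ≤ C ∧ ∀ (k r : ℕ) (T : TensorField r)
    (ε : ℝ), 4 ≤ k → 0 ≤ ε → MemSobolev k β T → sobolevNorm k β T ≤ ENNReal.ofReal ε →
      ∀ I, ∀ᵐ x, |T I x| ≤ C * ε ∧ ∀ i, |wpartial i (T I) x| ≤ C * ε * (weight x)⁻¹ := by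
  obtain ⟨C0, hC0, h0⟩ := HasWeightedL1.exists_ae_bound 0
  obtain ⟨C1, hC1, h1⟩ := HasWeightedL1.exists_ae_bound 1
  set B := (∫⁻ x, ENNReal.ofReal (weight x ^ (2 * β - 3))) ^ (1 / 2 : ℝ) with hB
  have hBt : B ≠ ⊤ := ENNReal.rpow_ne_top_of_nonneg (by norm_num)
    (lintegral_weight_rpow_lt_top (by linarith)).ne
  have hconv : ∀ (c C' t ε : ℝ) (N : ℝ≥0∞), 0 ≤ c → 0 ≤ C' → 0 ≤ ε → N ≤ ENNReal.ofReal ε →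
      ENNReal.ofReal c * ‖t‖ₑ ≤ ENNReal.ofReal C' * (N * B) → c * |t| ≤ C' * B.toReal * ε := by
    intro c C' t ε N hc hC' hε hN h
    rw [Real.enorm_eq_ofReal_abs, ← ENNReal.ofReal_mul hc] at h
    refine (ENNReal.ofReal_le_ofReal_iff (by positivity)).1 (h.trans ?_)
    rw [mul_right_comm, mul_assoc, ENNReal.ofReal_mul hC', mul_comm ε, mul_comm N B,
      ENNReal.ofReal_mul ENNReal.toReal_nonneg, ENNReal.ofReal_toReal hBt]
    gcongr
  refine ⟨max (C0 * B.toReal) (C1 * B.toReal), by positivity,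
    fun k r T ε hk hε hT hN I => ?_⟩
  have e0 : ∀ᵐ x, ENNReal.ofReal (weight x ^ (0 : ℝ)) * ‖T I x‖ₑ ≤
      ENNReal.ofReal C0 * (sobolevNorm k β T * B) := by
    refine h0 _ _ ((hT.1 I).1 [] (by simp)).aestronglyMeasurable ?_
    have := hT.hasWeightedL1 I (n := 3) (s := []) (by simp; omega)
    simp only [List.length_nil, Nat.cast_zero] at this
    exact this
  -- Three further derivatives of a first derivative: this is where `k ≥ 4` enters.
  have e1 : ∀ i, ∀ᵐ x, ENNReal.ofReal (weight x ^ (1 : ℝ)) * ‖wpartial i (T I) x‖ₑ ≤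
      ENNReal.ofReal C1 * (sobolevNorm k β T * B) := by
    intro i
    refine h1 _ _ ((hT.1 I).1 [i] (by simp; omega)).aestronglyMeasurable ?_
    have := hT.hasWeightedL1 I (n := 3) (s := [i]) (by simp; omega)
    simp only [List.length_singleton, Nat.cast_one] at this
    exact this
  filter_upwards [e0, ae_all_iff.2 e1] with x hx0 hx1
  refine ⟨?_, fun i => ?_⟩
  · have := hconv _ _ _ _ _ (Real.rpow_nonneg (weight_pos x).le _) hC0 hε hN hx0
    rw [Real.rpow_zero, one_mul] at this
    exact this.trans (mul_le_mul_of_nonneg_right (le_max_left _ _) hε)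
  · have := hconv _ _ _ _ _ (Real.rpow_nonneg (weight_pos x).le _) hC1 hε hN (hx1 i)
    rw [Real.rpow_one] at this
    rw [← div_eq_mul_inv, le_div_iff₀ (weight_pos x), mul_comm]
    exact this.trans (mul_le_mul_of_nonneg_right (le_max_right _ _) hε)

/-! ### Pointwise comparison of the operators of `δ + h` and `δ` -/

theorem abs_sum_three_le {f : Fin 3 → ℝ} {B : ℝ} (h : ∀ i, |f i| ≤ B) : |∑ i, f i| ≤ 3 * B := by
  refine (Finset.abs_sum_le_sum_abs _ _).trans ((Finset.sum_le_sum fun i _ => h i).trans ?_)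
  simp

/-- The operator `𝒟*_g` as a linear form in the covariant derivatives. -/
def adjDForm (Gi g : Fin 3 → Fin 3 → ℝ) (X : Fin 3 → Fin 3 → Fin 3 → Fin 3 → ℝ) (a c : Fin 3) : ℝ :=
  (∑ b, ∑ d, Gi b d * X d a b c) + (∑ b, ∑ d, Gi b d * X d c b a)
    - (2 / 3) * (∑ b, ∑ d, ∑ u, ∑ v, Gi b d * X d u b v * Gi u v) * g a c

/-- The operator `𝒬_g` as a linear form in the covariant derivatives. -/
def opQForm (E : Fin 3 → Fin 3 → Fin 3 → ℝ) (X : Fin 3 → Fin 3 → Fin 3 → Fin 3 → ℝ) (a : Fin 3) :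
    ℝ := ∑ e, ∑ b, ∑ c, E e b c * X e a b c

theorem adjDForm_sub (Gi g : Fin 3 → Fin 3 → ℝ) (X Y : Fin 3 → Fin 3 → Fin 3 → Fin 3 → ℝ)
    (a c : Fin 3) : adjDForm Gi g (fun d a b c => X d a b c - Y d a b c) a c =
      adjDForm Gi g X a c - adjDForm Gi g Y a c := by
  simp only [adjDForm, mul_sub, sub_mul, Finset.sum_sub_distrib]
  ring

theorem opQForm_sub (E : Fin 3 → Fin 3 → Fin 3 → ℝ) (X Y : Fin 3 → Fin 3 → Fin 3 → Fin 3 → ℝ)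
    (a : Fin 3) : opQForm E (fun d a b c => X d a b c - Y d a b c) a =
      opQForm E X a - opQForm E Y a := by
  simp only [opQForm, mul_sub, Finset.sum_sub_distrib]

/-- The Kronecker symbol. -/
def kron (a b : Fin 3) : ℝ := if a = b then 1 else 0

theorem abs_kron_le (a b : Fin 3) : |kron a b| ≤ 1 := by
  unfold kron; split_ifs <;> simp

theorem sum_kron_mul (b : Fin 3) (f : Fin 3 → ℝ) : ∑ d, kron b d * f d = f b := by
  simp [kron]

theorem flatD_eq (X : Fin 3 → Fin 3 → Fin 3 → Fin 3 → ℝ) (a c : Fin 3) :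
    flatD X a c = adjDForm kron kron X a c := by
  simp only [flatD, adjDForm, sum_kron_mul]
  congr 3
  refine Finset.sum_congr rfl fun b _ => ?_
  have h1 : ∀ d u, ∑ v, kron b d * X d u b v * kron u v = kron b d * X d u b u := fun d u => by
    simp only [mul_comm _ (kron u _), sum_kron_mul]
  simp only [h1, ← Finset.mul_sum, sum_kron_mul]

theorem abs_permSymbol_le (a b c : Fin 3) : |permSymbol a b c| ≤ 1 := by
  fin_cases a <;> fin_cases b <;> fin_cases c <;> norm_num [permSymbol]

theorem sum_kron_permSymbol (a b c : Fin 3) :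
    ∑ i, ∑ j, ∑ k, kron a i * kron b j * kron c k * permSymbol i j k = permSymbol a b c := by
  simp only [mul_assoc, ← Finset.mul_sum, sum_kron_mul]

/-- Iterating `A ↦ 2A + 1` from `A = 1` gives the factors `3`, `7`, `15` for products of two, three
and four entries. -/
theorem abs_mul_sub_mul_le {p q x u τ A : ℝ} (hp : |p - q| ≤ A * τ) (hx : |x - u| ≤ τ)
    (hq : |q| ≤ 1) (hu : |u| ≤ 1) (hτ : τ ≤ 1) : |p * x - q * u| ≤ (2 * A + 1) * τ := by
  have hτ0 : 0 ≤ τ := (abs_nonneg _).trans hx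
  have hx2 : |x| ≤ 2 := by
    calc |x| = |(x - u) + u| := by ring_nf
      _ ≤ |x - u| + |u| := abs_add_le _ _
      _ ≤ 2 := by linarith
  calc |p * x - q * u| = |(p - q) * x + q * (x - u)| := by ring_nf
    _ ≤ |p - q| * |x| + |q| * |x - u| := by
        refine (abs_add_le _ _).trans ?_; rw [abs_mul, abs_mul]
    _ ≤ A * τ * 2 + 1 * τ := by
        gcongr
        exact (abs_nonneg _).trans hp
    _ = _ := by ring

theorem abs_mul_le_of_le {x y A B : ℝ} (hx : |x| ≤ A) (hy : |y| ≤ B) : |x * y| ≤ A * B := by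
  rw [abs_mul]
  exact mul_le_mul hx hy (abs_nonneg _) ((abs_nonneg _).trans hx)

theorem abs_adjDForm_sub_flatD_le {Gi g : Fin 3 → Fin 3 → ℝ}
    {X : Fin 3 → Fin 3 → Fin 3 → Fin 3 → ℝ} {τ M : ℝ} (hτ : τ ≤ 1)
    (hGi : ∀ a b, |Gi a b - kron a b| ≤ τ) (hg : ∀ a b, |g a b - kron a b| ≤ τ)
    (hX : ∀ d a b c, |X d a b c| ≤ M) (a c : Fin 3) :
    |adjDForm Gi g X a c - flatD X a c| ≤ 396 * τ * M := by
  have h1 : ∀ a c, |(∑ b, ∑ d, Gi b d * X d a b c) - ∑ b, ∑ d, kron b d * X d a b c| ≤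
      3 * (3 * (τ * M)) := by
    intro a c
    simp only [← Finset.sum_sub_distrib, ← sub_mul]
    exact abs_sum_three_le fun b => abs_sum_three_le fun d => abs_mul_le_of_le (hGi b d) (hX d a b c)
  have h2 : |(∑ b, ∑ d, ∑ u, ∑ v, Gi b d * X d u b v * Gi u v) * g a c -
      (∑ b, ∑ d, ∑ u, ∑ v, kron b d * X d u b v * kron u v) * kron a c| ≤
      3 * (3 * (3 * (3 * (7 * τ * M)))) := by
    simp only [Finset.sum_mul, ← Finset.sum_sub_distrib]
    refine abs_sum_three_le fun b => abs_sum_three_le fun d => abs_sum_three_le fun u =>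
      abs_sum_three_le fun v => ?_
    have e1 := abs_mul_sub_mul_le (A := 1) (by simpa using hGi b d) (hGi u v) (abs_kron_le b d)
      (abs_kron_le u v) hτ
    have e2 := abs_mul_sub_mul_le e1 (hg a c)
      (by simpa using abs_mul_le_of_le (abs_kron_le b d) (abs_kron_le u v)) (abs_kron_le a c) hτ
    rw [show Gi b d * X d u b v * Gi u v * g a c - kron b d * X d u b v * kron u v * kron a c =
      (Gi b d * Gi u v * g a c - kron b d * kron u v * kron a c) * X d u b v by ring]
    exact abs_mul_le_of_le (e2.trans (le_of_eq (by norm_num))) (hX d u b v)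
  rw [flatD_eq, adjDForm, adjDForm]
  have h3 := h1 a c
  have h4 := h1 c a
  rw [abs_le] at h2 h3 h4 ⊢
  constructor <;> linarith

theorem abs_opQForm_sub_flatQ_le {Gi : Fin 3 → Fin 3 → ℝ} {E : Fin 3 → Fin 3 → Fin 3 → ℝ} {s : ℝ}
    {X : Fin 3 → Fin 3 → Fin 3 → Fin 3 → ℝ} {τ M : ℝ} (hτ : τ ≤ 1)
    (hGi : ∀ a b, |Gi a b - kron a b| ≤ τ) (hs : |s - 1| ≤ τ)
    (hE : ∀ a b c, E a b c = ∑ i, ∑ j, ∑ k, Gi a i * Gi b j * Gi c k * (s * permSymbol i j k))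
    (hX : ∀ d a b c, |X d a b c| ≤ M) (a : Fin 3) :
    |opQForm E X a - flatQ X a| ≤ 10935 * τ * M := by
  have h1 : ∀ a b c, |E a b c - permSymbol a b c| ≤ 3 * (3 * (3 * (15 * τ))) := by
    intro a b c
    rw [hE, ← sum_kron_permSymbol a b c]
    simp only [← Finset.sum_sub_distrib]
    refine abs_sum_three_le fun i => abs_sum_three_le fun j => abs_sum_three_le fun k => ?_
    have e1 := abs_mul_sub_mul_le (A := 1) (by simpa using hGi a i) (hGi b j) (abs_kron_le a i)
      (abs_kron_le b j) hτ
    have k1 : |kron a i * kron b j| ≤ 1 := by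
      simpa using abs_mul_le_of_le (abs_kron_le a i) (abs_kron_le b j)
    have e2 := abs_mul_sub_mul_le e1 (hGi c k) k1 (abs_kron_le c k) hτ
    have e3 := abs_mul_sub_mul_le e2 hs
      (by simpa using abs_mul_le_of_le k1 (abs_kron_le c k)) (by simp) hτ
    rw [show Gi a i * Gi b j * Gi c k * (s * permSymbol i j k) -
      kron a i * kron b j * kron c k * permSymbol i j k =
      (Gi a i * Gi b j * Gi c k * s - kron a i * kron b j * kron c k * 1) * permSymbol i j k by ring]
    refine (abs_mul_le_of_le e3 (abs_permSymbol_le i j k)).trans (le_of_eq (by norm_num))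
  simp only [opQForm, flatQ, ← Finset.sum_sub_distrib, ← sub_mul]
  refine (abs_sum_three_le fun e => abs_sum_three_le fun b => abs_sum_three_le fun c =>
    abs_mul_le_of_le (h1 e b c) (hX e a b c)).trans (le_of_eq (by ring))

theorem abs_flatD_le {X : Fin 3 → Fin 3 → Fin 3 → Fin 3 → ℝ} {M : ℝ}
    (hX : ∀ d a b c, |X d a b c| ≤ M) (a c : Fin 3) : |flatD X a c| ≤ 12 * M := by
  have h1 : ∀ a c, |∑ b, X b a b c| ≤ 3 * M := fun a c => abs_sum_three_le fun b => hX b a b c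
  have h2 : |(∑ b, ∑ u, X b u b u) * kron a c| ≤ 3 * (3 * M) * 1 :=
    abs_mul_le_of_le (abs_sum_three_le fun b => abs_sum_three_le fun u => hX b u b u)
      (abs_kron_le a c)
  have h3 := h1 a c
  have h4 := h1 c a
  rw [flatD, mul_assoc]
  change |_ + _ - 2 / 3 * (_ * kron a c)| ≤ _
  rw [abs_le] at h2 h3 h4 ⊢
  constructor <;> linarith

theorem abs_flatQ_le {X : Fin 3 → Fin 3 → Fin 3 → Fin 3 → ℝ} {M : ℝ}
    (hX : ∀ d a b c, |X d a b c| ≤ M) (a : Fin 3) : |flatQ X a| ≤ 27 * M :=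
  (abs_sum_three_le fun e => abs_sum_three_le fun b => abs_sum_three_le fun c =>
    abs_mul_le_of_le (abs_permSymbol_le e b c) (hX e a b c)).trans (le_of_eq (by ring))

theorem flatD_sub (X Y : Fin 3 → Fin 3 → Fin 3 → Fin 3 → ℝ) (a c : Fin 3) :
    flatD (fun d a b c => X d a b c - Y d a b c) a c = flatD X a c - flatD Y a c := by
  simp only [flatD_eq, adjDForm_sub]

theorem flatQ_sub (X Y : Fin 3 → Fin 3 → Fin 3 → Fin 3 → ℝ) (a : Fin 3) :
    flatQ (fun d a b c => X d a b c - Y d a b c) a = flatQ X a - flatQ Y a :=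
  opQForm_sub permSymbol X Y a

/-- If the operator of a metric close to `δ` annihilates the covariant derivative `∂J - Γ ⋆ J`, then
the flat operator is small. -/
theorem abs_flat_le {Gi g : Fin 3 → Fin 3 → ℝ} {E : Fin 3 → Fin 3 → Fin 3 → ℝ} {s τ γ mD mJ : ℝ}
    {D : Fin 3 → Fin 3 → Fin 3 → Fin 3 → ℝ} {J Γ : Fin 3 → Fin 3 → Fin 3 → ℝ}
    (hτ : τ ≤ 1) (hγ : 0 ≤ γ)
    (hGi : ∀ a b, |Gi a b - kron a b| ≤ τ) (hg : ∀ a b, |g a b - kron a b| ≤ τ) (hs : |s - 1| ≤ τ)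
    (hE : ∀ a b c, E a b c = ∑ i, ∑ j, ∑ k, Gi a i * Gi b j * Gi c k * (s * permSymbol i j k))
    (hD : ∀ d a b c, |D d a b c| ≤ mD) (hJ : ∀ a b c, |J a b c| ≤ mJ) (hΓ : ∀ a b c, |Γ a b c| ≤ γ)
    (hP : ∀ a c, adjDForm Gi g (fun d a b c => D d a b c -
      ∑ e, (Γ e d a * J e b c + Γ e d b * J a e c + Γ e d c * J a b e)) a c = 0)
    (hQ : ∀ a, opQForm E (fun d a b c => D d a b c -
      ∑ e, (Γ e d a * J e b c + Γ e d b * J a e c + Γ e d c * J a b e)) a = 0) :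
    (∀ a c, |flatD D a c| ≤ 100000 * (τ * mD + γ * mJ)) ∧
      ∀ a, |flatQ D a| ≤ 100000 * (τ * mD + γ * mJ) := by
  have hτ0 : 0 ≤ τ := (abs_nonneg _).trans hs
  have hmD : 0 ≤ mD := (abs_nonneg _).trans (hD 0 0 0 0)
  have hmJ : 0 ≤ mJ := (abs_nonneg _).trans (hJ 0 0 0)
  set Z : Fin 3 → Fin 3 → Fin 3 → Fin 3 → ℝ := fun d a b c =>
    ∑ e, (Γ e d a * J e b c + Γ e d b * J a e c + Γ e d c * J a b e) with hZ
  set Y : Fin 3 → Fin 3 → Fin 3 → Fin 3 → ℝ := fun d a b c => D d a b c - Z d a b c with hY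
  have hZb : ∀ d a b c, |Z d a b c| ≤ 9 * (γ * mJ) := by
    intro d a b c
    refine (abs_sum_three_le (B := γ * mJ + γ * mJ + γ * mJ) fun e => ?_).trans
      (le_of_eq (by ring))
    refine (abs_add_le _ _).trans (add_le_add ((abs_add_le _ _).trans (add_le_add ?_ ?_)) ?_) <;>
      exact abs_mul_le_of_le (hΓ _ _ _) (hJ _ _ _)
  have hYb : ∀ d a b c, |Y d a b c| ≤ mD + 9 * (γ * mJ) := fun d a b c =>
    (abs_sub _ _).trans (add_le_add (hD d a b c) (hZb d a b c))
  have hprod : τ * (γ * mJ) ≤ γ * mJ := mul_le_of_le_one_left (by positivity) hτ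
  have hγJ : 0 ≤ γ * mJ := by positivity
  have hτD : 0 ≤ τ * mD := by positivity
  refine ⟨fun a c => ?_, fun a => ?_⟩
  · have h1 := abs_adjDForm_sub_flatD_le hτ hGi hg hYb a c
    have h2 := abs_flatD_le hZb a c
    have h3 : flatD Y a c = flatD D a c - flatD Z a c := flatD_sub D Z a c
    rw [hP a c, zero_sub, abs_neg] at h1
    have h4 : |flatD D a c| ≤ |flatD Y a c| + |flatD Z a c| := by
      rw [show flatD D a c = flatD Y a c + flatD Z a c by rw [h3]; ring]
      exact abs_add_le _ _
    nlinarith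
  · have h1 := abs_opQForm_sub_flatQ_le hτ hGi hs hE hYb a
    have h2 := abs_flatQ_le hZb a
    have h3 : flatQ Y a = flatQ D a - flatQ Z a := flatQ_sub D Z a
    rw [hQ a, zero_sub, abs_neg] at h1
    have h4 : |flatQ D a| ≤ |flatQ Y a| + |flatQ Z a| := by
      rw [show flatQ D a = flatQ Y a + flatQ Z a by rw [h3]; ring]
      exact abs_add_le _ _
    -- This is the case that fixes `100000`: the coefficient of `γ * mJ` is at most `9 · 10935 + 9 ·
    -- 27 = 98658`.
    nlinarith

/-- Matrices close to the identity have inverse and determinant close to those of the identity. -/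
theorem exists_matrix_close {τ : ℝ} (hτ : 0 < τ) : ∃ η : ℝ, 0 < η ∧
    ∀ A : Fin 3 → Fin 3 → ℝ, (∀ a b, |A a b - kron a b| ≤ η) →
      (∀ a b, |(Matrix.of A)⁻¹ a b - kron a b| ≤ τ) ∧ |Real.sqrt (Matrix.of A).det - 1| ≤ τ := by
  have hof : Continuous fun A : Fin 3 → Fin 3 → ℝ => (Matrix.of A : Matrix (Fin 3) (Fin 3) ℝ) :=
    continuous_id
  have hkron : (Matrix.of kron : Matrix (Fin 3) (Fin 3) ℝ) = 1 := by
    ext a b; simp [kron, Matrix.one_apply]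
  have hinv : ∀ a b, ∀ᶠ A in 𝓝 kron, |(Matrix.of A)⁻¹ a b - kron a b| < τ := by
    intro a b
    have h1 : ContinuousAt (fun A : Fin 3 → Fin 3 → ℝ => (Matrix.of A)⁻¹) kron := by
      refine ContinuousAt.comp (f := fun A : Fin 3 → Fin 3 → ℝ => Matrix.of A)
        (g := fun A : Matrix (Fin 3) (Fin 3) ℝ => A⁻¹) (continuousAt_matrix_inv _ ?_) hof.continuousAt
      rw [hkron, Matrix.det_one, Ring.inverse_eq_inv']
      exact continuousAt_inv₀ one_ne_zero
    have h2 : ContinuousAt (fun A : Fin 3 → Fin 3 → ℝ => (Matrix.of A)⁻¹ a b) kron :=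
      (continuous_apply_apply a b).continuousAt.comp h1
    have h3 := (Metric.tendsto_nhds.1 h2) τ hτ
    filter_upwards [h3] with A hA
    rw [hkron, inv_one] at hA
    simpa [Real.dist_eq, kron, Matrix.one_apply] using hA
  have hdet : ∀ᶠ A in 𝓝 kron, |Real.sqrt (Matrix.of A).det - 1| < τ := by
    have h2 : ContinuousAt (fun A : Fin 3 → Fin 3 → ℝ => Real.sqrt (Matrix.of A).det) kron :=
      (Real.continuous_sqrt.comp hof.matrix_det).continuousAt
    filter_upwards [(Metric.tendsto_nhds.1 h2) τ hτ] with A hA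
    rw [hkron, Matrix.det_one, Real.sqrt_one] at hA
    exact hA
  have hall : ∀ᶠ A in 𝓝 kron, (∀ a b, |(Matrix.of A)⁻¹ a b - kron a b| < τ) ∧
      |Real.sqrt (Matrix.of A).det - 1| < τ :=
    (eventually_all.2 fun a => eventually_all.2 fun b => hinv a b).and hdet
  obtain ⟨δ, hδ, hball⟩ := Metric.eventually_nhds_iff.1 hall
  refine ⟨δ / 2, by positivity, fun A hA => ?_⟩
  have hd : dist A kron < δ := by
    refine lt_of_le_of_lt ?_ (half_lt_self hδ)
    refine (dist_pi_le_iff (by positivity)).2 fun a => (dist_pi_le_iff (by positivity)).2 fun b => ?_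
    exact hA a b
  exact ⟨fun a b => ((hball hd).1 a b).le, (hball hd).2.le⟩

theorem abs_christoffel_le {g : TensorField 2} {x : E3} {p : ℝ}
    (hinv : ∀ a b, |ginv g a b x| ≤ 2) (hd : ∀ a b c, |wpartial a (g ![b, c]) x| ≤ p)
    (c a b : Fin 3) : |christoffel g c a b x| ≤ 9 * p := by
  have h1 : |∑ d : Fin 3, ginv g c d x *
      (wpartial a (g ![b, d]) x + wpartial b (g ![a, d]) x - wpartial d (g ![a, b]) x)| ≤
      3 * (2 * (p + p + p)) := by
    refine abs_sum_three_le fun d => abs_mul_le_of_le (hinv c d) ?_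
    refine (abs_sub _ _).trans (add_le_add ((abs_add_le _ _).trans (add_le_add ?_ ?_)) ?_) <;>
      exact hd _ _ _
  rw [christoffel, abs_mul, abs_of_nonneg (by norm_num : (0 : ℝ) ≤ 1 / 2)]
  linarith

/-! ### Injectivity -/

/-- The difference of two tensor fields, in components. -/
def diffComp (J₁ J₂ : TensorField 3) (a b c : Fin 3) (x : E3) : ℝ :=
  J₁ ![a, b, c] x - J₂ ![a, b, c] x

/-- The weak partial derivatives of the difference of two tensor fields, in components. -/
def diffDeriv (J₁ J₂ : TensorField 3) (k a b c : Fin 3) (x : E3) : ℝ :=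
  wpartial k (J₁ ![a, b, c]) x - wpartial k (J₂ ![a, b, c]) x

theorem abs_le_sqrt_sqNorm (D : Fin 3 → Fin 3 → Fin 3 → Fin 3 → ℝ) (k a b c : Fin 3) :
    |D k a b c| ≤ Real.sqrt (sqNorm D) := by
  refine Real.abs_le_sqrt ?_
  have h1 : D k a b c ^ 2 ≤ ∑ c, D k a b c ^ 2 :=
    Finset.single_le_sum (f := fun c => D k a b c ^ 2) (fun _ _ => sq_nonneg _) (Finset.mem_univ c)
  have h2 : (∑ c, D k a b c ^ 2) ≤ ∑ b, ∑ c, D k a b c ^ 2 :=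
    Finset.single_le_sum (f := fun b => ∑ c, D k a b c ^ 2)
      (fun _ _ => Finset.sum_nonneg fun _ _ => sq_nonneg _) (Finset.mem_univ b)
  have h3 : (∑ b, ∑ c, D k a b c ^ 2) ≤ ∑ a, ∑ b, ∑ c, D k a b c ^ 2 :=
    Finset.single_le_sum (f := fun a => ∑ b, ∑ c, D k a b c ^ 2)
      (fun _ _ => Finset.sum_nonneg fun _ _ => Finset.sum_nonneg fun _ _ => sq_nonneg _)
      (Finset.mem_univ a)
  have h4 : (∑ a, ∑ b, ∑ c, D k a b c ^ 2) ≤ sqNorm D :=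
    Finset.single_le_sum (f := fun k => ∑ a, ∑ b, ∑ c, D k a b c ^ 2)
      (fun _ _ => Finset.sum_nonneg fun _ _ => Finset.sum_nonneg fun _ _ =>
        Finset.sum_nonneg fun _ _ => sq_nonneg _) (Finset.mem_univ k)
  exact h1.trans (h2.trans (h3.trans h4))

theorem abs_le_sqrt_sum_sq (J : Fin 3 → Fin 3 → Fin 3 → ℝ) (a b c : Fin 3) :
    |J a b c| ≤ Real.sqrt (∑ a, ∑ b, ∑ c, J a b c ^ 2) := by
  refine Real.abs_le_sqrt ?_
  have h1 : J a b c ^ 2 ≤ ∑ c, J a b c ^ 2 :=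
    Finset.single_le_sum (f := fun c => J a b c ^ 2) (fun _ _ => sq_nonneg _) (Finset.mem_univ c)
  have h2 : (∑ c, J a b c ^ 2) ≤ ∑ b, ∑ c, J a b c ^ 2 :=
    Finset.single_le_sum (f := fun b => ∑ c, J a b c ^ 2)
      (fun _ _ => Finset.sum_nonneg fun _ _ => sq_nonneg _) (Finset.mem_univ b)
  have h3 : (∑ b, ∑ c, J a b c ^ 2) ≤ ∑ a, ∑ b, ∑ c, J a b c ^ 2 :=
    Finset.single_le_sum (f := fun a => ∑ b, ∑ c, J a b c ^ 2)
      (fun _ _ => Finset.sum_nonneg fun _ _ => Finset.sum_nonneg fun _ _ => sq_nonneg _)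
      (Finset.mem_univ a)
  exact h1.trans (h2.trans h3)

/-- Pointwise smallness of the flat operator on the difference of two tensor fields with the same
image under the operator of a metric close to `δ`. -/
theorem abs_flat_diff_le {h : TensorField 2} {J₁ J₂ : TensorField 3} {x : E3} {τ η : ℝ}
    (hτ0 : 0 < τ) (hτ : τ ≤ 1) (hητ : η ≤ τ)
    (hη : ∀ A : Fin 3 → Fin 3 → ℝ, (∀ a b, |A a b - kron a b| ≤ η) →
      (∀ a b, |(Matrix.of A)⁻¹ a b - kron a b| ≤ τ) ∧ |Real.sqrt (Matrix.of A).det - 1| ≤ τ)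
    (hh : ∀ a b, |h ![a, b] x| ≤ η)
    (hdh : ∀ a b c, |wpartial a ((euclid + h) ![b, c]) x| ≤ τ / 9 * (weight x)⁻¹)
    (hP : ∀ a c, (auxOp h J₁).1 ![a, c] x = (auxOp h J₂).1 ![a, c] x)
    (hQ : ∀ a, (auxOp h J₁).2 ![a] x = (auxOp h J₂).2 ![a] x) :
    (∑ a, ∑ c, flatD (fun k a b c => diffDeriv J₁ J₂ k a b c x) a c ^ 2) +
        ∑ a, flatQ (fun k a b c => diffDeriv J₁ J₂ k a b c x) a ^ 2 ≤
      24 * (100000 * τ) ^ 2 * (sqNorm (fun k a b c => diffDeriv J₁ J₂ k a b c x) +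
        ∑ a, ∑ b, ∑ c, diffComp J₁ J₂ a b c x ^ 2 * weight x ^ (-2 : ℝ)) := by
  set g := euclid + h with hgdef
  set G : Fin 3 → Fin 3 → ℝ := fun a b => g ![a, b] x with hG
  have hGk : ∀ a b, G a b - kron a b = h ![a, b] x := fun a b => by
    simp [hG, hgdef, euclid, kron]
  have hGη : ∀ a b, |G a b - kron a b| ≤ η := fun a b => by rw [hGk]; exact hh a b
  obtain ⟨hinv, hdet⟩ := hη G hGη
  have hwp := weight_pos x
  have hΓ : ∀ a b c, |christoffel g a b c x| ≤ τ * (weight x)⁻¹ := by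
    intro a b c
    have h2 : ∀ a b, |ginv g a b x| ≤ 2 := fun a b => by
      have h1 : |ginv g a b x - kron a b| ≤ τ := hinv a b
      have h3 := abs_kron_le a b
      calc |ginv g a b x| = |(ginv g a b x - kron a b) + kron a b| := by ring_nf
        _ ≤ _ := (abs_add_le _ _).trans (by linarith)
    refine (abs_christoffel_le h2 hdh a b c).trans (le_of_eq (by ring))
  set D : Fin 3 → Fin 3 → Fin 3 → Fin 3 → ℝ := fun k a b c => diffDeriv J₁ J₂ k a b c x with hD
  set J : Fin 3 → Fin 3 → Fin 3 → ℝ := fun a b c => diffComp J₁ J₂ a b c x with hJ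
  have hcov : (fun d a b c => D d a b c - ∑ e, (christoffel g e d a x * J e b c +
      christoffel g e d b x * J a e c + christoffel g e d c x * J a b e)) =
      fun d a b c => covDeriv g J₁ d a b c x - covDeriv g J₂ d a b c x := by
    funext d a b c
    simp only [hD, hJ, diffDeriv, diffComp, covDeriv, Fin.sum_univ_three]
    ring
  obtain ⟨hfD, hfQ⟩ := abs_flat_le (Gi := fun a b => ginv g a b x) (g := G)
    (E := fun a b c => volFormUp g a b c x) (s := Real.sqrt (gram g x).det)
    (D := D) (J := J) (Γ := fun a b c => christoffel g a b c x) (γ := τ * (weight x)⁻¹)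
    hτ (by positivity) hinv (fun a b => (hGη a b).trans hητ) hdet (fun a b c => rfl)
    (abs_le_sqrt_sqNorm D) (abs_le_sqrt_sum_sq J) hΓ
    (fun a c => by rw [hcov, adjDForm_sub, sub_eq_zero]; exact hP a c)
    (fun a => by rw [hcov, opQForm_sub, sub_eq_zero]; exact hQ a)
  set mD := Real.sqrt (sqNorm D) with hmD
  set mJ := Real.sqrt (∑ a, ∑ b, ∑ c, J a b c ^ 2) with hmJ
  have sD : mD ^ 2 = sqNorm D := Real.sq_sqrt (Finset.sum_nonneg fun _ _ => Finset.sum_nonneg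
    fun _ _ => Finset.sum_nonneg fun _ _ => Finset.sum_nonneg fun _ _ => sq_nonneg _)
  have sJ : mJ ^ 2 = ∑ a, ∑ b, ∑ c, J a b c ^ 2 := Real.sq_sqrt (Finset.sum_nonneg fun _ _ =>
    Finset.sum_nonneg fun _ _ => Finset.sum_nonneg fun _ _ => sq_nonneg _)
  have hB : (100000 * (τ * mD + τ * (weight x)⁻¹ * mJ)) ^ 2 ≤
      2 * (100000 * τ) ^ 2 * (sqNorm D + ∑ a, ∑ b, ∑ c, J a b c ^ 2 * weight x ^ (-2 : ℝ)) := by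
    simp only [← Finset.sum_mul]
    rw [← sD, ← sJ, weight_rpow_neg_two, ← inv_pow]
    have h1 : (mD + (weight x)⁻¹ * mJ) ^ 2 ≤ 2 * (mD ^ 2 + mJ ^ 2 * (weight x)⁻¹ ^ 2) := by
      nlinarith [sq_nonneg (mD - (weight x)⁻¹ * mJ)]
    calc _ = (100000 * τ) ^ 2 * (mD + (weight x)⁻¹ * mJ) ^ 2 := by ring
      _ ≤ (100000 * τ) ^ 2 * (2 * (mD ^ 2 + mJ ^ 2 * (weight x)⁻¹ ^ 2)) := by gcongr
      _ = _ := by ring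
  have hsqD : ∀ a c, flatD D a c ^ 2 ≤ _ := fun a c =>
    (sq_le_sq' (neg_le_of_abs_le (hfD a c)) (le_of_abs_le (hfD a c))).trans hB
  have hsqQ : ∀ a, flatQ D a ^ 2 ≤ _ := fun a =>
    (sq_le_sq' (neg_le_of_abs_le (hfQ a)) (le_of_abs_le (hfQ a))).trans hB
  -- There are `9 + 3 = 12` components, each with the factor `2` from `hB`; hence `24`.
  refine (add_le_add (Finset.sum_le_sum fun a _ => Finset.sum_le_sum fun c _ => hsqD a c)
    (Finset.sum_le_sum fun a _ => hsqQ a)).trans (le_of_eq ?_)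
  simp only [Finset.sum_const, Finset.card_univ, Fintype.card_fin, nsmul_eq_mul]
  push_cast
  ring

theorem integrable_sq_mul_weight {f : E3 → ℝ} (hf : MemLp f 2 volume) :
    Integrable (fun x => f x ^ 2 * weight x ^ (-2 : ℝ)) := by
  obtain ⟨C, hC⟩ := IsSymbol.weight_rpow 0 (-2)
  refine (hf.integrable_mul (memLp_symbol_mul hC (by norm_num) hf)).congr (ae_of_all _ fun x => ?_)
  simp only [Pi.mul_apply]; ring

/-- The absorption argument: a Jacobi tensor field in `H²` vanishes if the flat operator on it is
bounded by a small multiple of the gradient and of the field divided by the weight. -/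
theorem ae_eq_zero_of_flat_le {u : Fin 3 → Fin 3 → Fin 3 → E3 → ℝ}
    {D : Fin 3 → Fin 3 → Fin 3 → Fin 3 → E3 → ℝ} {κ : ℝ} (hκ0 : 0 ≤ κ) (hκ : 40 * κ ≤ 1)
    (hu : ∀ k a b c, HasWeakPartial k (u a b c) (D k a b c))
    (mu : ∀ a b c, MemLp (u a b c) 2 volume) (mD : ∀ k a b c, MemLp (D k a b c) 2 volume)
    (hD : ∀ l k a b c, ∃ H, HasWeakPartial l (D k a b c) H ∧ MemLp H 2 volume)
    (hcyc : ∀ a b c, ∀ᵐ x, u a b c x + u c a b x + u b c a x = 0)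
    (hanti : ∀ a b c, ∀ᵐ x, u a b c x + u a c b x = 0)
    (hflat : ∀ᵐ x, (∑ a, ∑ c, flatD (fun k a b c => D k a b c x) a c ^ 2) +
        ∑ a, flatQ (fun k a b c => D k a b c x) a ^ 2 ≤
      κ * (sqNorm (fun k a b c => D k a b c x) +
        ∑ a, ∑ b, ∑ c, u a b c x ^ 2 * weight x ^ (-2 : ℝ))) (a b c : Fin 3) :
    ∀ᵐ x, u a b c x = 0 := by
  have hcoer := integral_sqNorm_le hu mu mD hD hcyc hanti
  have iu : Integrable (fun x => ∑ a, ∑ b, ∑ c, u a b c x ^ 2 * weight x ^ (-2 : ℝ)) :=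
    integrable_finsetSum _ fun a _ => integrable_finsetSum _ fun b _ =>
      integrable_finsetSum _ fun c _ => integrable_sq_mul_weight (mu a b c)
  have hhardy : ∫ x, ∑ a, ∑ b, ∑ c, u a b c x ^ 2 * weight x ^ (-2 : ℝ) ≤
      4 * ∫ x, sqNorm (fun k a b c => D k a b c x) := by
    have e1 : ∫ x, ∑ a, ∑ b, ∑ c, u a b c x ^ 2 * weight x ^ (-2 : ℝ) =
        ∑ a, ∑ b, ∑ c, ∫ x, u a b c x ^ 2 * weight x ^ (-2 : ℝ) := by
      rw [integral_finsetSum _ fun a _ => integrable_finsetSum _ fun b _ =>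
        integrable_finsetSum _ fun c _ => integrable_sq_mul_weight (mu a b c)]
      refine Finset.sum_congr rfl fun a _ => ?_
      rw [integral_finsetSum _ fun b _ =>
        integrable_finsetSum _ fun c _ => integrable_sq_mul_weight (mu a b c)]
      refine Finset.sum_congr rfl fun b _ => ?_
      rw [integral_finsetSum _ fun c _ => integrable_sq_mul_weight (mu a b c)]
    have e2 : ∫ x, sqNorm (fun k a b c => D k a b c x) =
        ∑ k, ∑ a, ∑ b, ∑ c, ∫ x, D k a b c x ^ 2 := by
      simp only [sqNorm]
      rw [integral_finsetSum _ fun k _ => integrable_finsetSum _ fun a _ =>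
        integrable_finsetSum _ fun b _ => integrable_finsetSum _ fun c _ =>
          (mD k a b c).integrable_sq]
      refine Finset.sum_congr rfl fun k _ => ?_
      rw [integral_finsetSum _ fun a _ => integrable_finsetSum _ fun b _ =>
        integrable_finsetSum _ fun c _ => (mD k a b c).integrable_sq]
      refine Finset.sum_congr rfl fun a _ => ?_
      rw [integral_finsetSum _ fun b _ => integrable_finsetSum _ fun c _ =>
        (mD k a b c).integrable_sq]
      refine Finset.sum_congr rfl fun b _ => ?_
      rw [integral_finsetSum _ fun c _ => (mD k a b c).integrable_sq]
    rw [e1, e2]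
    have hb := fun a b c => integral_hardy_le (fun k => hu k a b c) (mu a b c)
      (fun k => mD k a b c)
    refine (Finset.sum_le_sum fun a _ => Finset.sum_le_sum fun b _ => Finset.sum_le_sum
      fun c _ => hb a b c).trans (le_of_eq ?_)
    simp only [Fin.sum_univ_three]
    ring
  have hsm := integral_mono_ae (integrable_flat_sq mD)
    (((integrable_sqNorm mD).add iu).const_mul κ) hflat
  have hsplit : ∫ x, κ * ((fun x => sqNorm (fun k a b c => D k a b c x)) +
      fun x => ∑ a, ∑ b, ∑ c, u a b c x ^ 2 * weight x ^ (-2 : ℝ)) x =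
      κ * ((∫ x, sqNorm (fun k a b c => D k a b c x)) +
        ∫ x, ∑ a, ∑ b, ∑ c, u a b c x ^ 2 * weight x ^ (-2 : ℝ)) := by
    rw [integral_const_mul]
    simp only [Pi.add_apply]
    rw [integral_add (integrable_sqNorm mD) iu]
  have hN0 : 0 ≤ ∫ x, sqNorm (fun k a b c => D k a b c x) :=
    integral_nonneg fun x => Finset.sum_nonneg fun _ _ => Finset.sum_nonneg fun _ _ =>
      Finset.sum_nonneg fun _ _ => Finset.sum_nonneg fun _ _ => sq_nonneg _
  -- With `N` the integral on the left, coercivity, smallness and Hardy give `N ≤ 4κ(N + 4N) = 20κN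
  -- ≤ N/2`.
  have hN : ∫ x, sqNorm (fun k a b c => D k a b c x) ≤ 0 := by
    have h1 := hsm.trans (le_of_eq hsplit)
    nlinarith
  have hterm : ∀ x, 0 ≤ ∑ a, ∑ b, ∑ c, u a b c x ^ 2 * weight x ^ (-2 : ℝ) := fun x =>
    Finset.sum_nonneg fun _ _ => Finset.sum_nonneg fun _ _ => Finset.sum_nonneg fun _ _ =>
      mul_nonneg (sq_nonneg _) (Real.rpow_nonneg (weight_pos x).le _)
  have hz : ∫ x, ∑ a, ∑ b, ∑ c, u a b c x ^ 2 * weight x ^ (-2 : ℝ) = 0 :=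
    le_antisymm (by linarith) (integral_nonneg hterm)
  filter_upwards [(integral_eq_zero_iff_of_nonneg hterm iu).1 hz] with x hx
  have hw : 0 < weight x ^ (-2 : ℝ) := Real.rpow_pos_of_pos (weight_pos x) _
  simp only [Pi.zero_apply, ← Finset.sum_mul] at hx
  have h1 := (mul_eq_zero.1 hx).resolve_right hw.ne'
  have h2 := abs_le_sqrt_sum_sq (fun a b c => u a b c x) a b c
  rw [h1, Real.sqrt_zero] at h2
  exact abs_eq_zero.1 (le_antisymm h2 (abs_nonneg _))

/-- Injectivity of the auxiliary operator for all metrics close to `δ`, with a uniform threshold. -/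
theorem exists_auxOpInjective {β : ℝ} (hβ : β < 0) : ∃ ε₀ : ℝ, 0 < ε₀ ∧ ∀ (k : ℕ)
    (h : TensorField 2), 4 ≤ k → MemSobolev k β h → sobolevNorm k β h ≤ ENNReal.ofReal ε₀ →
      AuxOpInjective (k - 2) (β - 2) h := by
  obtain ⟨C, hC0, hC⟩ := exists_ae_bound hβ
  -- Small enough for absorption: `κ = 24 (10⁵ τ)² = 0.0024`, so `40κ < 1`.
  set τ : ℝ := 1 / 10 ^ 7 with hτ
  have hτ0 : 0 < τ := by positivity
  obtain ⟨η', hη'0, hη'⟩ := exists_matrix_close hτ0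
  -- `η'` controls the inverse and the determinant; `τ / 9` compensates the factor `9` in
  -- `abs_christoffel_le`.
  set η := min η' (τ / 9) with hη
  have hη0 : 0 < η := lt_min hη'0 (by positivity)
  have hε : 0 < η / (C + 1) := by positivity
  have hCε : C * (η / (C + 1)) ≤ η := by
    rw [mul_div_assoc', div_le_iff₀ (by positivity)]
    nlinarith
  refine ⟨η / (C + 1), hε, fun k h hk hS hN J₁ J₂ hJ₁ hJac₁ hJ₂ hJac₂ hP hQ => ?_⟩
  have hbd := hC k 2 h _ hk hε.le hS hN
  have wd : ∀ {J : TensorField 3}, MemSobolev (k - 2) (β - 2) J → ∀ (I : Fin 3 → Fin 3) (i : Fin 3),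
      HasWeakPartial i (J I) (wpartial i (J I)) := fun hJ I i =>
    (hJ.1 I).2 [] (by simp only [List.length_nil]; omega) i
  have wd2 : ∀ {J : TensorField 3}, MemSobolev (k - 2) (β - 2) J → ∀ (I : Fin 3 → Fin 3)
      (i j : Fin 3), HasWeakPartial j (wpartial i (J I)) (wpartial j (wpartial i (J I))) :=
    fun hJ I i j => (hJ.1 I).2 [i] (by simp only [List.length_singleton]; omega) j
  -- The weight exponent at order `l` is `1 - 2β + 2l > 0`, so the weighted norm dominates the `L²`
  -- norm.
  have ml : ∀ {J : TensorField 3}, MemSobolev (k - 2) (β - 2) J → ∀ (I : Fin 3 → Fin 3)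
      (s : List (Fin 3)), s.length ≤ 2 → MemLp (wderiv s (J I)) 2 volume := fun hJ I s hs =>
    hJ.memLp_wderiv I (by omega) (by
      have : (0 : ℝ) ≤ s.length := Nat.cast_nonneg _
      linarith)
  have hzero := ae_eq_zero_of_flat_le (u := diffComp J₁ J₂) (D := diffDeriv J₁ J₂)
    (κ := 24 * (100000 * τ) ^ 2) (by positivity) (by rw [hτ]; norm_num)
    (fun k a b c => (wd hJ₁ ![a, b, c] k).sub (wd hJ₂ ![a, b, c] k))
    (fun a b c => (ml hJ₁ ![a, b, c] [] (by simp)).sub (ml hJ₂ ![a, b, c] [] (by simp)))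
    (fun k a b c => (ml hJ₁ ![a, b, c] [k] (by simp)).sub (ml hJ₂ ![a, b, c] [k] (by simp)))
    (fun l k a b c => ⟨_, (wd2 hJ₁ ![a, b, c] k l).sub (wd2 hJ₂ ![a, b, c] k l),
      (ml hJ₁ ![a, b, c] [l, k] (by simp)).sub (ml hJ₂ ![a, b, c] [l, k] (by simp))⟩)
    (fun a b c => by
      filter_upwards [hJac₁ a b c, hJac₂ a b c] with x h1 h2
      simp only [diffComp]; linarith [h1.1, h2.1])
    (fun a b c => by
      filter_upwards [hJac₁ a b c, hJac₂ a b c] with x h1 h2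
      simp only [diffComp]; linarith [h1.2, h2.2])
    ?_
  · intro I
    have hI : I = ![I 0, I 1, I 2] := by ext i; fin_cases i <;> rfl
    filter_upwards [hzero (I 0) (I 1) (I 2)] with x hx
    rw [hI]
    exact sub_eq_zero.1 hx
  · have hg : ∀ a b c, ∀ᵐ x, wpartial a ((euclid + h) ![b, c]) x = wpartial a (h ![b, c]) x := by
      intro a b c
      have h1 : HasWeakPartial a (h ![b, c]) (wpartial a (h ![b, c])) :=
        (hS.1 ![b, c]).2 [] (by simp only [List.length_nil]; omega) a
      have h2 := (HasWeakPartial.const a (kron b c)).add h1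
      simp only [zero_add] at h2
      exact h2.wpartial_ae_eq
    have hb : ∀ a b, ∀ᵐ x, |h ![a, b] x| ≤ C * (η / (C + 1)) ∧
        ∀ i, |wpartial i (h ![a, b]) x| ≤ C * (η / (C + 1)) * (weight x)⁻¹ := fun a b => hbd ![a, b]
    have hP' : ∀ a c, ∀ᵐ x, (auxOp h J₁).1 ![a, c] x = (auxOp h J₂).1 ![a, c] x := fun a c =>
      hP ![a, c]
    have hQ' : ∀ a, ∀ᵐ x, (auxOp h J₁).2 ![a] x = (auxOp h J₂).2 ![a] x := fun a => hQ ![a]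
    simp only [← ae_all_iff] at hg hb hP' hQ'
    filter_upwards [hg, hb, hP', hQ'] with x h1 h2 h3 h4
    refine abs_flat_diff_le hτ0 (by rw [hτ]; norm_num) ((min_le_right _ _).trans (by linarith))
      (fun A hA => hη' A fun a b => (hA a b).trans (min_le_left _ _))
      (fun a b => (h2 a b).1.trans hCε) (fun a b c => ?_) h3 h4
    rw [h1]
    refine ((h2 b c).2 a).trans ?_
    have := weight_pos x
    gcongr
    exact hCε.trans (min_le_right _ _)

end ExtConstraint

end

theorem mainTheorem6 (k : ℕ) (hk : 4 ≤ k) (β : ℝ) (hβ : β ∈ Set.Ioo (-1 : ℝ) 0) :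
    -- all metrics `δ + h` with `h` small in `H^{k,β}`, with a uniform threshold
    (∃ ε₀ : ℝ, 0 < ε₀ ∧ ∀ h : ExtConstraint.TensorField 2,
      ExtConstraint.MemSobolev k β h → ExtConstraint.IsSymmetric h →
      ExtConstraint.sobolevNorm k β h ≤ ENNReal.ofReal ε₀ →
      ExtConstraint.AuxOpInjective (k - 2) (β - 2) h) ∧
    -- families `b ↦ δ + h b` over the free data, with `h b → 0` in `H^{k,β}` as `b → 0`
    (∀ h : ExtConstraint.DataTriple → ExtConstraint.TensorField 2,
      (∀ η : ℝ, 0 < η → ∃ ρ : ℝ, 0 < ρ ∧ ∀ b : ExtConstraint.DataTriple,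
        ExtConstraint.IsFreeData k β b →
        ExtConstraint.freeDataNorm k β b ≤ ENNReal.ofReal ρ →
        ExtConstraint.MemSobolev k β (h b) ∧ ExtConstraint.IsSymmetric (h b) ∧
          ExtConstraint.sobolevNorm k β (h b) ≤ ENNReal.ofReal η) →
      ∃ ε₀ : ℝ, 0 < ε₀ ∧ ∀ b : ExtConstraint.DataTriple,
        ExtConstraint.IsFreeData k β b →
        ExtConstraint.freeDataNorm k β b ≤ ENNReal.ofReal ε₀ →
        ExtConstraint.AuxOpInjective (k - 2) (β - 2) (h b)) := by
  obtain ⟨ε₀, hε₀, hinj⟩ := ExtConstraint.exists_auxOpInjective hβ.2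
  refine ⟨⟨ε₀, hε₀, fun h hS _ hN => hinj k h hk hS hN⟩, fun h hh => ?_⟩
  -- The threshold of the first part serves as the tolerance in the continuity of `h` at `0`.
  obtain ⟨ρ, hρ, hb⟩ := hh ε₀ hε₀
  refine ⟨ρ, hρ, fun b hfree hnorm => ?_⟩
  obtain ⟨hS, -, hN⟩ := hb b hfree hnorm
  exact hinj k (h b) hk hS hN
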